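/- **Setting.** Let $d,k\ge 1$. Let $\mathcal S\subset\mathbb R^d$ be a bounded convex set with non-empty interior (for instance $[0,1]^d$), whose points ${\bm s}$ are the samples of signals at times $t_1,\dots,t_d$. *HP-splines.* For $\beta\in\mathbb R$ let $\mathbb E_{4,\beta}=\mathrm{span}\{e^{\beta t},te^{\beta t},e^{-\beta t},te^{-\beta t}\}$ (cubic polynomials if $\beta=0$). Let $\xi_j=\xi_1+(j-1)h$ be uniform knots of step $h>0$, and for each $\beta$ let $B_0^\beta,\dots,B_{m+1}^\beta$ be a hyperbolic B-spline basis: $B_j^\beta$ is a bell-shaped $C^2$ function that vanishes exactly outside $(\xi_{j-2},\xi_{j+2})$ and belongs to $\mathbb E_{4,\beta}$ on each knot interval. For $\lambda>0$, $s_{\rm hp}({\bm s};\beta)$ denotes an HP-spline fitting ${\bm s}$, i.e. $\sum_{j=0}^{m+1}a_jB_j^\beta$ with $(a_j)$ a minimizer of $$\sum_{i=1}^d\Big({\bm s}_i-\sum_j a_jB_j^\beta(t_i)\Big)^2+\lambda^2\sum_{j=2}^{m+1}\big(a_j-2e^{-\beta h}a_{j-1}+e^{-2\beta h}a_{j-2}\big)^2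 .$$ The norm $\|\cdot\|_{L^\infty}$ is taken over a fixed compact time interval. *ReLU networks.* A ReLU network has $d$ inputs, hidden units $\max(0,\sum w_kx_k+b)$ organized in layers, each fed by units of previous layers, and one affine output unit. Its depth is the number of layers (input and output layers included); its size is the number of connections plus the number of computational units. **Assumptions.** Let $\alpha:\mathcal S\to\mathbb R$, and let $E,E_{\rm hp}\subset\mathcal S$ be finite. 1. $\alpha$ is continuous on $\mathcal S\setminus E$ and $\alpha\in W^{k,\infty}(\mathrm{int}\,\mathcal S\setminus E)$ with $\|\alpha\|_{W^{k,\infty}}\le1$ (the norm being the maximum of the essential suprema of the weak derivatives of order at most $k$). The values $\alpha({\bm s})$, ${\bm s}\in\mathcal S\setminus E$, lie in an interval $J=[A_0,A_1]$. 2. $\mathcal S\setminus(E\cup E_{\rm hp})$ is covered by finitely many regions $\mathcal R_i$, and for each ${\bm s}\in\mathcal R_i\setminus(E\cup E_{\rm hp})$ in $\mathcal S$ the map $\beta\mapsto s_{\rm hp}({\bm s};\beta)$ is locally Lipschitz on $J$ with constant $L_{{\rm hp},i}>0$, in the $L^\infty$ norm. Put $L_{\rm hp}=\max_iL_{{\rm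 hp},i}$. 3. There is a (possibly empty) family of "flat" ranges $A\subset\mathbb R$ and a constant $L_{\rm flat}>0$ (typically $L_{\rm flat}\ll L_{\rm hp}$) such that $\|s_{\rm hp}({\bm s};\beta_1)-s_{\rm hp}({\bm s};\beta_2)\|_{L^\infty}\le L_{\rm flat}|\beta_1-\beta_2|$ for all flat ranges $A$, all $\beta_1,\beta_2\in A$ and all ${\bm s}\in\mathcal S\setminus(E\cup E_{\rm hp})$. **Conclusion.** Put $L_{\rm eff}=\max(L_{\rm hp},L_{\rm flat})$. There are a constant $c>0$, depending only on $d$, $k$ and an upper bound for the diameter of $\mathcal S$, and a constant $C>0$, depending on the data above but not on $\varepsilon$, such that for every $\varepsilon>0$ and every compact $K\subset\mathcal S\setminus E$ there is a ReLU network $F_\theta$ with the following properties. (a) If $\varepsilon\le\frac12$, its depth is at most $c\log(1/\varepsilon)$ and its size is at most $c\big(\varepsilon^{-d/k}\log(1/\varepsilon)+|E\cup E_{\rm hp}|\big)$. (b) It predicts $\alpha$: $|F_\theta({\bm s})-\alpha({\bm s})|\le\varepsilon$ for all ${\bm s}\in K$ and, if $d\ge2$, for all ${\bm s}\in\mathcal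 S\setminus E$. (c) For every ${\bm s}\in\mathcal S$ and every signal $s:\mathbb R\to\mathbb R$ with $s(t_j)={\bm s}_j$ for $j=1,\dots,d$, $$\|s-s_{\rm hp}({\bm s};F_\theta({\bm s}))\|_{L^\infty}\le\|s-s_{\rm hp}({\bm s};\alpha({\bm s}))\|_{L^\infty}+L_{\rm eff}\,\varepsilon+C\sum_{{\bm s}_i\in E\cup E_{\rm hp}}|F_\theta({\bm s}_i)-\alpha({\bm s}_i)| .$$ If moreover ${\bm s}\notin E\cup E_{\rm hp}$ and $\alpha({\bm s})$, $F_\theta({\bm s})$ lie in one flat range, then $L_{\rm eff}$ may be replaced by $L_{\rm flat}$. -/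

import Mathlib

open MeasureTheory Set Topology
open scoped ENNReal ContDiff

namespace HPS

noncomputable section

/-! ### Hyperbolic-polynomial penalized splines -/

/-- The space `𝔼_{4,α}`, spanned by `e^{αt}, t e^{αt}, e^{-αt}, t e^{-αt}`. At `α = 0`, where these
functions degenerate, it is the space of cubic polynomials. In both cases it is the solution space
of `(D² - α²)² u = 0`. -/
def expSpace (α : ℝ) : Submodule ℝ (ℝ → ℝ) :=
  if α = 0 then
    Submodule.span ℝ {fun _ => 1, fun t => t, fun t => t ^ 2, fun t => t ^ 3}
  else
    Submodule.span ℝ {fun t => Real.exp (α * t), fun t => t * Real.exp (α * t),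
      fun t => Real.exp (-α * t), fun t => t * Real.exp (-α * t)}

/-- The uniform knots `ξ_j = ξ₁ + (j - 1) h`. The knots `ξ_1, …, ξ_m` are continued uniformly to
both sides, as the supports of the outer basis functions require. -/
def knot (ξ₁ h : ℝ) (j : ℤ) : ℝ := ξ₁ + ((j : ℝ) - 1) * h

/-- `B 0, …, B (m+1)` is a hyperbolic B-spline basis with frequency `α` on the uniform knots
`ξ_1, …, ξ_m` of step `h`: each `B j` is of class `C²`, is in `𝔼_{4,α}` on each knot interval,
is supported on the five consecutive knots `ξ_{j-2}, …, ξ_{j+2}`, and is bell-shaped.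
(Each `B j` is determined by this up to a positive factor.) -/
structure IsHyperbolicBSplineBasis (ξ₁ h : ℝ) (m : ℕ) (α : ℝ) (B : Fin (m + 2) → ℝ → ℝ) :
    Prop where
  contDiff : ∀ j, ContDiff ℝ 2 (B j)
  piecewise : ∀ j, ∀ i : ℤ, ∃ p ∈ expSpace α,
    EqOn (B j) p (Icc (knot ξ₁ h i) (knot ξ₁ h (i + 1)))
  support : ∀ j, Function.support (B j) =
    Ioo (knot ξ₁ h ((j : ℕ) - 2)) (knot ξ₁ h ((j : ℕ) + 2))
  nonneg : ∀ j t, 0 ≤ B j t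
  monotoneOn : ∀ j, MonotoneOn (B j) (Iic (knot ξ₁ h (j : ℕ)))
  antitoneOn : ∀ j, AntitoneOn (B j) (Ici (knot ξ₁ h (j : ℕ)))

/-- The spline `∑_j a_j B_j`. -/
def spline {m : ℕ} (B : Fin (m + 2) → ℝ → ℝ) (a : Fin (m + 2) → ℝ) : ℝ → ℝ :=
  fun t => ∑ j, a j * B j t

/-- The penalized least-squares functional
`∑_i (y_i - ∑_j a_j B_j(t_i))² + λ² ∑_{j=2}^{m+1} (a_j - 2 e^{-αh} a_{j-1} + e^{-2αh} a_{j-2})²`. -/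
def penalizedFunctional {d m : ℕ} (h α lam : ℝ) (B : Fin (m + 2) → ℝ → ℝ) (t y : Fin d → ℝ)
    (a : Fin (m + 2) → ℝ) : ℝ :=
  ∑ i, (y i - spline B a (t i)) ^ 2 +
    lam ^ 2 * ∑ j : Fin m, (a j.succ.succ - 2 * Real.exp (-α * h) * a j.castSucc.succ
      + Real.exp (-2 * α * h) * a j.castSucc.castSucc) ^ 2

/-- `σ` is an HP-spline with frequency `α` fitting the data `(t_i, y_i)`: its coefficients minimize
the penalized least-squares functional. -/
def IsHPSpline {d m : ℕ} (h α lam : ℝ) (B : Fin (m + 2) → ℝ → ℝ) (t y : Fin d → ℝ)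
    (σ : ℝ → ℝ) : Prop :=
  ∃ a : Fin (m + 2) → ℝ,
    (∀ b, penalizedFunctional h α lam B t y a ≤ penalizedFunctional h α lam B t y b) ∧
      σ = spline B a

/-- The `L^∞` norm of `f` on the time interval `[T₀, T₁]`. -/
def supNorm (T₀ T₁ : ℝ) (f : ℝ → ℝ) : ℝ≥0∞ :=
  eLpNorm f ∞ (volume.restrict (Icc T₀ T₁))

/-- The one-parameter family `u β` of functions on `[T₀, T₁]` is Lipschitz in `β ∈ A` with constant
`L`, in the `L^∞` norm. -/
def LipschitzInParam (T₀ T₁ L : ℝ) (u : ℝ → ℝ → ℝ) (A : Set ℝ) : Prop :=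
  ∀ β₁ ∈ A, ∀ β₂ ∈ A, supNorm T₀ T₁ (u β₁ - u β₂) ≤ ENNReal.ofReal (L * |β₁ - β₂|)

/-- The family `u β` is locally Lipschitz in `β ∈ A` with constant `L`. -/
def LocallyLipschitzInParam (T₀ T₁ L : ℝ) (u : ℝ → ℝ → ℝ) (A : Set ℝ) : Prop :=
  ∀ β ∈ A, ∃ V ∈ 𝓝[A] β, LipschitzInParam T₀ T₁ L u V

/-! ### The Sobolev space `W^{k,∞}` -/

/-- The partial derivative `∂_{i_1} ⋯ ∂_{i_n} φ`. -/
def partialDeriv {d n : ℕ} (i : Fin n → Fin d) (φ : (Fin d → ℝ) → ℝ) (x : Fin d → ℝ) : ℝ :=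
  iteratedFDeriv ℝ n φ x (fun j => Pi.single (i j) 1)

/-- `g` is the weak partial derivative `∂_{i_1} ⋯ ∂_{i_n} f` on the open set `U`. -/
def IsWeakPartialDeriv {d n : ℕ} (U : Set (Fin d → ℝ)) (i : Fin n → Fin d)
    (f g : (Fin d → ℝ) → ℝ) : Prop :=
  LocallyIntegrableOn f U ∧ LocallyIntegrableOn g U ∧
    ∀ φ : (Fin d → ℝ) → ℝ, ContDiff ℝ ∞ φ → HasCompactSupport φ → tsupport φ ⊆ U →
      ∫ x in U, f x * partialDeriv i φ x = (-1) ^ n * ∫ x in U, g x * φ x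

/-- `f ∈ W^{k,∞}(U)` and `‖f‖_{W^{k,∞}(U)} ≤ M`, where the norm is the maximum over all partial
derivatives of order at most `k` of the `L^∞` norm of the weak derivative. -/
def SobolevNormLE {d : ℕ} (k : ℕ) (U : Set (Fin d → ℝ)) (f : (Fin d → ℝ) → ℝ) (M : ℝ) : Prop :=
  ∀ n ≤ k, ∀ i : Fin n → Fin d, ∃ g, IsWeakPartialDeriv U i f g ∧
    eLpNorm g ∞ (volume.restrict U) ≤ ENNReal.ofReal M

/-! ### ReLU networks -/

/-- A feedforward ReLU network with `d` input units, `units` hidden computational units and one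
linear output unit. The hidden units are organized in layers `1, 2, …`, and the inputs of a unit
are input units or hidden units of lower layers. -/
structure ReLUNetwork (d : ℕ) where
  /-- the number of hidden computational units -/
  units : ℕ
  /-- the layer of a hidden unit -/
  layer : Fin units → ℕ
  /-- the units that feed a hidden unit -/
  sources : Fin units → Finset (Fin d ⊕ Fin units)
  /-- the weights of the connections into a hidden unit -/
  weight : Fin units → Fin d ⊕ Fin units → ℝ
  /-- the bias of a hidden unit -/
  bias : Fin units → ℝ
  /-- the units that feed the output unit -/
  outSources : Finset (Fin d ⊕ Fin units)
  /-- the weights of the connections into the output unit -/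
  outWeight : Fin d ⊕ Fin units → ℝ
  /-- the bias of the output unit -/
  outBias : ℝ
  layer_pos : ∀ i, 1 ≤ layer i
  feedForward : ∀ i j, Sum.inr j ∈ sources i → layer j < layer i

namespace ReLUNetwork

variable {d : ℕ}

/-- The output of the hidden unit `i` on the input `x`:
`max 0 (∑ w_k x_k + b)`, the sum running over the units that feed it. -/
def value (N : ReLUNetwork d) (x : Fin d → ℝ) (i : Fin N.units) : ℝ :=
  max 0 (∑ p : {p // p ∈ N.sources i},
    N.weight i p.1 * (match h : p.1 with
      | Sum.inl a => x a
      | Sum.inr j => value N x j) + N.bias i)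
termination_by N.layer i
decreasing_by exact N.feedForward i j (h ▸ p.2)

/-- The function computed by the network. -/
def eval (N : ReLUNetwork d) (x : Fin d → ℝ) : ℝ :=
  ∑ p ∈ N.outSources, N.outWeight p * Sum.elim x (N.value x) p + N.outBias

/-- The number of layers: the input layer, the hidden layers and the output layer. -/
def depth (N : ReLUNetwork d) : ℕ := Finset.univ.sup N.layer + 2

/-- The total number of weights: one for each connection and one (the bias) for each computational
unit, the output unit included. -/
def size (N : ReLUNetwork d) : ℕ :=
  (∑ i, (N.sources i).card + N.outSources.card) + (N.units + 1)

theorem value_eq (N : ReLUNetwork d) (x : Fin d → ℝ) (i : Fin N.units) :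
    N.value x i =
      max 0 (∑ p ∈ N.sources i, N.weight i p * Sum.elim x (N.value x) p + N.bias i) := by
  rw [value, ← Finset.sum_coe_sort (N.sources i)]
  congr 3
  funext p
  rcases p with ⟨p | p, hp⟩ <;> rfl

end ReLUNetwork

end

end HPS

/-!
The frequency map is approximated by gluing local Taylor polynomials with a continuous piecewise
linear partition of unity, in such a way that the cost is `O(number of cells + log (1/ε))`.

*Taylor polynomials.* Mollifications of `α` have partial derivatives of order at most `k` bounded
by `1`, because these derivatives fall on the mollifier and the definition of the weak derivative
moves them to `α` (`abs_partialDeriv_mollify_le`). Taylor's formula passes to the limit, by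
compactness of the set of bounded jets: at every point `x₀` of the convex set there is a polynomial
of degree less than `k` with bounded coefficients that approximates `α` at `x` to order
`‖x - x₀‖ ^ k` whenever the segment from `x₀` to `x` avoids `E` (`exists_jet`). In dimension at
least two almost every segment avoids `E`, so the points of `E` are removable
(`exists_extension`). In dimension one they separate the domain and `α` may jump there.

*Gluing.* The functions `hat (y - c)`, `c ∈ ℤ^d`, are the nodal functions of the Kuhn triangulation.
The value `hat (y - c)` is the probability that `c = ⌊y + θ⌋` coordinatewise for `θ` uniform in
`[0, 1)`, so they form a partition of unity (`sum_hat_eq_one`); each of them is computed by a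
network of constant size. If all local polynomials are expanded around one point, the glued
function is `∑_j P_j(x) · monomial_j(x)` over a bounded number of `j`, where `P_j` is the piecewise
linear function with the `j`-th coefficients as nodal values. Products are needed only for each
`j`; they come from the expansion of `y - y²` in iterated tent functions and cost `O(log (1/ε))`
units (`exists_glued_circuit`).

*Features and corrections.* The cells are unit cubes for a feature map, which is a rescaling of `ℝ^d`
when the singular points are removable. In dimension one a piecewise linear step of height `2` is
added at each point of `E`, so that no cell contains points of `K` on different sides of a
singular point (`exists_jumpFeature`). Narrow spikes then make the network take prescribed values at
the points of `E ∪ Ehp`, and its output is truncated to `[A₀, A₁]` (`exists_network_of_local`).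

*Reconstruction.* Off `E ∪ Ehp` the error bound follows from the Lipschitz bounds, since a locally
Lipschitz family on an interval is Lipschitz. At a point `g` of `E ∪ Ehp` the network takes a value
`v g` that does not depend on `ε`; either `v g = α g`, or the term `C |v g - α g|` absorbs the fixed
distance of the two splines. In dimension one, the values at the points of `E` are chosen at
distance at least `(A₁ - A₀) / 2` from `α`, so that the sum over `E ∪ Ehp` also controls the error
at points outside `K`, where the network has to cross a jump of `α`
(`exists_frequency_network`).
-/

namespace HPS

noncomputable section

/-! ### Taylor polynomials and mollification of Sobolev functions -/

/-- The polynomial `∑_{n<k} (1/n!) ∑_i a_{n,i} v_{i_1} ⋯ v_{i_n}` with jet `a`. -/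
def jetPoly {d : ℕ} (k : ℕ) (a : (n : ℕ) → (Fin n → Fin d) → ℝ) (v : Fin d → ℝ) : ℝ :=
  ∑ n ∈ Finset.range k, ((n.factorial : ℝ))⁻¹ * ∑ i : Fin n → Fin d, a n i * ∏ j, v (i j)

theorem iteratedFDeriv_diag_eq_sum {d n : ℕ} (f : (Fin d → ℝ) → ℝ) (x v : Fin d → ℝ) :
    iteratedFDeriv ℝ n f x (fun _ => v) =
      ∑ i : Fin n → Fin d, partialDeriv i f x * ∏ j, v (i j) := by
  have hv : v = ∑ a, v a • (Pi.single a (1 : ℝ) : Fin d → ℝ) := by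
    conv_lhs => rw [← Finset.univ_sum_single v]
    refine Finset.sum_congr rfl fun a _ => ?_
    ext b
    simp [Pi.single_apply]
  conv_lhs => rw [hv]
  rw [ContinuousMultilinearMap.map_sum]
  refine Finset.sum_congr rfl fun i _ => ?_
  rw [ContinuousMultilinearMap.map_smul_univ, partialDeriv, smul_eq_mul, mul_comm]

theorem abs_iteratedFDeriv_diag_le {d n : ℕ} {f : (Fin d → ℝ) → ℝ} {x : Fin d → ℝ}
    (hb : ∀ i : Fin n → Fin d, |partialDeriv i f x| ≤ 1) (v : Fin d → ℝ) :
    |iteratedFDeriv ℝ n f x (fun _ => v)| ≤ (d : ℝ) ^ n * ‖v‖ ^ n := by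
  rw [iteratedFDeriv_diag_eq_sum]
  calc |∑ i : Fin n → Fin d, partialDeriv i f x * ∏ j, v (i j)|
      ≤ ∑ i : Fin n → Fin d, |partialDeriv i f x * ∏ j, v (i j)| := Finset.abs_sum_le_sum_abs _ _
    _ ≤ ∑ _i : Fin n → Fin d, ‖v‖ ^ n := by
        refine Finset.sum_le_sum fun i _ => ?_
        rw [abs_mul, Finset.abs_prod]
        calc |partialDeriv i f x| * ∏ j, |v (i j)| ≤ 1 * ∏ _j : Fin n, ‖v‖ := by
              gcongr with j
              · exact hb i
              · exact norm_le_pi_norm v (i j)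
          _ = ‖v‖ ^ n := by simp
    _ = (d : ℝ) ^ n * ‖v‖ ^ n := by simp

/-- Taylor's formula, with a remainder bound that only uses the partial derivatives on the segment
from the centre. -/
theorem abs_sub_jetPoly_le {d k : ℕ} (hk : 1 ≤ k) {f : (Fin d → ℝ) → ℝ} (hf : ContDiff ℝ ∞ f)
    (x₀ x : Fin d → ℝ)
    (hb : ∀ y ∈ segment ℝ x₀ x, ∀ i : Fin k → Fin d, |partialDeriv i f y| ≤ 1) :
    |f x - jetPoly k (fun _ i => partialDeriv i f x₀) (x - x₀)| ≤ (d : ℝ) ^ k * ‖x - x₀‖ ^ k := by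
  obtain ⟨m, rfl⟩ : ∃ m, k = m + 1 := ⟨k - 1, by omega⟩
  have h := map_add_eq_sum_add_integral_iteratedFDeriv (n := m) (f := f) (x := x₀) (y := x - x₀)
    (fun t _ => (hf.of_le (by exact_mod_cast le_top)).contDiffAt)
  rw [add_sub_cancel] at h
  have hj : jetPoly (m + 1) (fun _ i => partialDeriv i f x₀) (x - x₀) =
      ∑ n ∈ Finset.range (m + 1),
        ((n.factorial : ℝ))⁻¹ • iteratedFDeriv ℝ n f x₀ (fun _ => x - x₀) := by
    simp only [jetPoly, iteratedFDeriv_diag_eq_sum, smul_eq_mul]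
  rw [hj, h, add_sub_cancel_left, smul_eq_mul, abs_mul]
  have hint : |∫ t in (0 : ℝ)..1, (1 - t) ^ m •
      iteratedFDeriv ℝ (m + 1) f (x₀ + t • (x - x₀)) (fun _ => x - x₀)| ≤
      (d : ℝ) ^ (m + 1) * ‖x - x₀‖ ^ (m + 1) * |1 - 0| := by
    rw [← Real.norm_eq_abs]
    refine intervalIntegral.norm_integral_le_of_norm_le_const fun t ht => ?_
    rw [uIoc_of_le zero_le_one] at ht
    rw [norm_smul, Real.norm_eq_abs, Real.norm_eq_abs]
    have h1 : |(1 - t) ^ m| ≤ 1 := by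
      rw [abs_of_nonneg (pow_nonneg (by linarith [ht.2]) m)]
      exact pow_le_one₀ (by linarith [ht.2]) (by linarith [ht.1])
    have h2 := abs_iteratedFDeriv_diag_le (n := m + 1) (f := f) (x := x₀ + t • (x - x₀))
      (hb _ (by
        rw [segment_eq_image']
        exact ⟨t, ⟨ht.1.le, ht.2⟩, rfl⟩)) (x - x₀)
    calc _ ≤ 1 * _ := mul_le_mul h1 h2 (abs_nonneg _) zero_le_one
      _ = _ := one_mul _
  have hfac : |((m.factorial : ℝ))⁻¹| ≤ 1 := by
    rw [abs_of_nonneg (by positivity)]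
    exact inv_le_one_of_one_le₀ (by exact_mod_cast m.factorial_pos)
  calc _ ≤ 1 * _ := mul_le_mul hfac hint (abs_nonneg _) zero_le_one
    _ = _ := by simp

theorem contDiff_partialDeriv {d n : ℕ} (i : Fin n → Fin d) {φ : (Fin d → ℝ) → ℝ}
    (hφ : ContDiff ℝ ∞ φ) : ContDiff ℝ ∞ (partialDeriv i φ) := by
  have h : ContDiff ℝ ∞ (iteratedFDeriv ℝ n φ) := hφ.iteratedFDeriv_right (by exact_mod_cast le_top)
  exact (ContinuousMultilinearMap.apply ℝ _ ℝ (fun j => Pi.single (i j) (1 : ℝ))).contDiff.comp h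

theorem hasCompactSupport_partialDeriv {d n : ℕ} (i : Fin n → Fin d) {φ : (Fin d → ℝ) → ℝ}
    (hc : HasCompactSupport φ) : HasCompactSupport (partialDeriv i φ) :=
  (hc.iteratedFDeriv (𝕜 := ℝ) n).comp_left
    (g := fun T : (Fin d → ℝ) [×n]→L[ℝ] ℝ => T (fun j => Pi.single (i j) (1 : ℝ))) rfl

theorem partialDeriv_succ {d n : ℕ} (i : Fin (n + 1) → Fin d) {φ : (Fin d → ℝ) → ℝ}
    (hφ : ContDiff ℝ ∞ φ) (x : Fin d → ℝ) :
    partialDeriv i φ x = fderiv ℝ (partialDeriv (Fin.tail i) φ) x (Pi.single (i 0) 1) := by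
  have hd : DifferentiableAt ℝ (iteratedFDeriv ℝ n φ) x :=
    hφ.contDiffAt.differentiableAt_iteratedFDeriv (by exact_mod_cast WithTop.coe_lt_top _)
  rw [partialDeriv, hd.iteratedFDeriv_succ_apply_left']
  rfl

/-- Reflection and translation act on partial derivatives by a sign. -/
theorem partialDeriv_comp_sub_left {d n : ℕ} (i : Fin n → Fin d) {φ : (Fin d → ℝ) → ℝ}
    (hφ : ContDiff ℝ ∞ φ) (x y : Fin d → ℝ) :
    partialDeriv i (fun z => φ (x - z)) y = (-1) ^ n * partialDeriv i φ (x - y) := by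
  induction n generalizing y with
  | zero => simp [partialDeriv]
  | succ n ih =>
    have hs : ContDiff ℝ ∞ fun z => φ (x - z) := hφ.comp (contDiff_const.sub contDiff_id)
    rw [partialDeriv_succ i hs, partialDeriv_succ i hφ]
    have h1 : partialDeriv (Fin.tail i) (fun z => φ (x - z)) =
        fun z => (-1) ^ n * partialDeriv (Fin.tail i) φ (x - z) := funext fun z => ih _ z
    have hd : HasFDerivAt (partialDeriv (Fin.tail i) φ)
        (fderiv ℝ (partialDeriv (Fin.tail i) φ) (x - y)) (x - y) :=
      ((contDiff_partialDeriv _ hφ).differentiable (by simp)).differentiableAt.hasFDerivAt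
    have h2 : HasFDerivAt (fun z => (-1) ^ n * partialDeriv (Fin.tail i) φ (x - z))
        ((-1 : ℝ) ^ n • (fderiv ℝ (partialDeriv (Fin.tail i) φ) (x - y)).comp
          (-ContinuousLinearMap.id ℝ (Fin d → ℝ))) y := by
      refine HasFDerivAt.const_mul ?_ _
      have := hd.comp y ((hasFDerivAt_const x y).sub (hasFDerivAt_id y))
      simpa using! this
    rw [h1, h2.fderiv]
    simp [pow_succ]

/-- Every partial derivative of a convolution falls on the smooth factor. -/
theorem partialDeriv_convolution {d n : ℕ} (i : Fin n → Fin d) {φ g : (Fin d → ℝ) → ℝ}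
    (hφ : ContDiff ℝ ∞ φ) (hc : HasCompactSupport φ) (hg : LocallyIntegrable g) :
    partialDeriv i (convolution φ g (ContinuousLinearMap.lsmul ℝ ℝ) volume) =
      convolution (partialDeriv i φ) g (ContinuousLinearMap.lsmul ℝ ℝ) volume := by
  induction n with
  | zero =>
    have h : ∀ f : (Fin d → ℝ) → ℝ, partialDeriv i f = f := fun f => by
      ext x; simp [partialDeriv]
    rw [h, h]
  | succ n ih =>
    have hs : ContDiff ℝ ∞ (convolution φ g (ContinuousLinearMap.lsmul ℝ ℝ) volume) :=
      hc.contDiff_convolution_left (n := ⊤) _ hφ hg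
    ext x
    rw [partialDeriv_succ i hs, ih]
    have hd := (hasCompactSupport_partialDeriv (Fin.tail i) hc).hasFDerivAt_convolution_left
      (ContinuousLinearMap.lsmul ℝ ℝ) (μ := volume)
      ((contDiff_partialDeriv (Fin.tail i) hφ).of_le (by simp)) hg x
    rw [hd.fderiv]
    have he := (((hasCompactSupport_partialDeriv (Fin.tail i) hc).fderiv ℝ).convolutionExists_left
      ((ContinuousLinearMap.lsmul ℝ ℝ).precompL (Fin d → ℝ)) (μ := volume)
      ((contDiff_partialDeriv (Fin.tail i) hφ).continuous_fderiv (by simp)) hg x)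
    rw [convolution, convolution, ContinuousLinearMap.integral_apply he]
    refine integral_congr_ae (Filter.Eventually.of_forall fun t => ?_)
    simp only [ContinuousLinearMap.precompL_apply, ContinuousLinearMap.lsmul_apply]
    rw [partialDeriv_succ i hφ]

/-- Where the mollification of `f` only sees values of `f` in `U`, its partial derivatives are
averages of the weak derivatives of `f`. -/
theorem abs_partialDeriv_mollify_le {d k n : ℕ} {U : Set (Fin d → ℝ)} (hU : IsOpen U)
    {f : (Fin d → ℝ) → ℝ} (hf : SobolevNormLE k U f 1) (hfi : LocallyIntegrable (U.indicator f))
    (φ : ContDiffBump (0 : Fin d → ℝ)) {x : Fin d → ℝ} (hx : Metric.closedBall x φ.rOut ⊆ U)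
    (hn : n ≤ k) (i : Fin n → Fin d) :
    |partialDeriv i (convolution (φ.normed volume) (U.indicator f)
      (ContinuousLinearMap.lsmul ℝ ℝ) volume) x| ≤ 1 := by
  obtain ⟨g, ⟨-, -, hg⟩, hg1⟩ := hf n hn i
  have hφ : ContDiff ℝ ∞ (φ.normed volume) := φ.contDiff_normed
  have hψ : ContDiff ℝ ∞ fun z => φ.normed volume (x - z) :=
    hφ.comp (contDiff_const.sub contDiff_id)
  have hsupp : tsupport (fun z => φ.normed volume (x - z)) ⊆ Metric.closedBall x φ.rOut := by
    refine closure_minimal (fun z hz => ?_) Metric.isClosed_closedBall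
    have h1 : x - z ∈ Function.support (φ.normed volume) := hz
    rw [φ.support_normed_eq, mem_ball_zero_iff] at h1
    rw [Metric.mem_closedBall, dist_comm, dist_eq_norm]
    exact h1.le
  have hψc : HasCompactSupport fun z => φ.normed volume (x - z) :=
    (isCompact_closedBall x φ.rOut).of_isClosed_subset (isClosed_tsupport _) hsupp
  have hw := hg _ hψ hψc (hsupp.trans hx)
  have hval : partialDeriv i (convolution (φ.normed volume) (U.indicator f)
      (ContinuousLinearMap.lsmul ℝ ℝ) volume) x = ∫ t in U, g t * φ.normed volume (x - t) := by
    rw [partialDeriv_convolution i hφ φ.hasCompactSupport_normed hfi, convolution_lsmul_swap]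
    have h1 : ∀ t, partialDeriv i (φ.normed volume) (x - t) • U.indicator f t =
        U.indicator (fun t => (-1) ^ n *
          (f t * partialDeriv i (fun z => φ.normed volume (x - z)) t)) t := by
      intro t
      by_cases ht : t ∈ U
      · rw [indicator_of_mem ht, indicator_of_mem ht, partialDeriv_comp_sub_left i hφ, smul_eq_mul]
        have : ((-1 : ℝ) ^ n) * (-1) ^ n = 1 := by rw [← mul_pow]; simp
        linear_combination (-(partialDeriv i (φ.normed volume) (x - t) * f t)) * this
      · rw [indicator_of_notMem ht, indicator_of_notMem ht, smul_zero]
    simp_rw [h1]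
    rw [integral_indicator hU.measurableSet, integral_const_mul, hw, ← mul_assoc, ← mul_pow]
    simp
  rw [hval, ← Real.norm_eq_abs]
  have hint : Integrable (fun t => φ.normed volume (x - t)) :=
    (φ.integrable_normed).comp_sub_left x
  calc ‖∫ t in U, g t * φ.normed volume (x - t)‖
      ≤ ∫ t in U, φ.normed volume (x - t) := by
        refine norm_integral_le_of_norm_le hint.integrableOn ?_
        have hae : ∀ᵐ t ∂(volume.restrict U), ‖g t‖ₑ ≤ ENNReal.ofReal 1 := by
          filter_upwards [ae_le_eLpNormEssSup (f := g) (μ := volume.restrict U)] with t ht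
          exact ht.trans (by simpa using hg1)
        filter_upwards [hae] with t ht
        have h2 : ‖g t‖ ≤ 1 := by
          rw [ENNReal.ofReal_one] at ht
          exact_mod_cast (by simpa [enorm_le_iff_norm_le, ← ofReal_norm] using ht)
        rw [norm_mul, Real.norm_of_nonneg (φ.nonneg_normed _)]
        exact mul_le_of_le_one_left (φ.nonneg_normed _) h2
    _ ≤ ∫ t, φ.normed volume (x - t) :=
        setIntegral_le_integral hint (Filter.Eventually.of_forall fun t => φ.nonneg_normed _)
    _ = 1 := by rw [integral_sub_left_eq_self (fun t => φ.normed volume t) volume x,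
        φ.integral_normed]

/-! ### Local jets on a convex set with finitely many exceptional points -/

theorem continuous_jetPoly {d : ℕ} (k : ℕ) :
    Continuous fun q : ((n : ℕ) → (Fin n → Fin d) → ℝ) × (Fin d → ℝ) => jetPoly k q.1 q.2 := by
  unfold jetPoly
  fun_prop

/-- The contraction of a convex set towards an interior point leaves room around its image. -/
theorem ball_contraction_subset_interior {d : ℕ} {S : Set (Fin d → ℝ)} (hS : Convex ℝ S)
    {p : Fin d → ℝ} {r : ℝ} (hp : Metric.ball p r ⊆ S) {z : Fin d → ℝ} (hz : z ∈ S) {τ : ℝ}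
    (h0 : 0 < τ) (h1 : τ ≤ 1) :
    Metric.ball ((1 - τ) • z + τ • p) (r * τ) ⊆ interior S := by
  intro w hw
  have hq : p + τ⁻¹ • (w - ((1 - τ) • z + τ • p)) ∈ interior S := by
    refine interior_maximal hp Metric.isOpen_ball ?_
    rw [mem_ball_iff_norm, add_sub_cancel_left, norm_smul, norm_inv, Real.norm_of_nonneg h0.le,
      inv_mul_lt_iff₀ h0, mul_comm]
    rwa [mem_ball_iff_norm] at hw
  have := hS.combo_self_interior_mem_interior hz hq (sub_nonneg.2 h1) h0 (by ring)
  convert this using 1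
  rw [smul_add, smul_smul, mul_inv_cancel₀ h0.ne', one_smul]
  abel

theorem integrable_indicator_of_bounded {d : ℕ} {S U : Set (Fin d → ℝ)} {α : (Fin d → ℝ) → ℝ}
    (hU : IsOpen U) (hUS : U ⊆ S) (hS : Bornology.IsBounded S) (hα : ContinuousOn α U) {M : ℝ}
    (hM : ∀ s ∈ U, |α s| ≤ M) : Integrable (U.indicator α) := by
  rw [integrable_indicator_iff hU.measurableSet]
  refine IntegrableOn.of_bound (hS.subset hUS).measure_lt_top
    (hα.aestronglyMeasurable hU.measurableSet) M ?_
  filter_upwards [ae_restrict_mem hU.measurableSet] with s hs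
  exact hM s hs

/-- A function of class `W^{k,∞}` has a Taylor polynomial at each point of a convex set, valid on
all segments from this point that avoid the exceptional set. The polynomial is a limit of Taylor
polynomials of mollifications at points moved slightly into the interior. -/
theorem exists_jet {d k : ℕ} (hk : 1 ≤ k) {S : Set (Fin d → ℝ)} (hS : Convex ℝ S)
    (hint : (interior S).Nonempty) (hbdd : Bornology.IsBounded S) {E : Finset (Fin d → ℝ)}
    {α : (Fin d → ℝ) → ℝ} (hα : ContinuousOn α (S \ E)) {M : ℝ} (hM : ∀ s ∈ S \ E, |α s| ≤ M)
    (hW : SobolevNormLE k (interior S \ E) α 1) {x₀ : Fin d → ℝ} (hx₀ : x₀ ∈ S) :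
    ∃ a : (n : ℕ) → (Fin n → Fin d) → ℝ, (∀ n i, |a n i| ≤ 1) ∧
      ∀ x ∈ S, (∀ e ∈ E, e ∉ segment ℝ x₀ x) →
        |α x - jetPoly k a (x - x₀)| ≤ (d : ℝ) ^ k * ‖x - x₀‖ ^ k := by
  obtain ⟨p, hp⟩ := hint
  obtain ⟨r, hr, hpr⟩ := Metric.isOpen_iff.1 isOpen_interior p hp
  have hprS : Metric.ball p r ⊆ S := hpr.trans interior_subset
  set U : Set (Fin d → ℝ) := interior S \ E with hUdef
  have hU : IsOpen U := isOpen_interior.sdiff E.finite_toSet.isClosed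
  have hUS : U ⊆ S \ E := sdiff_subset_sdiff_left interior_subset
  have hfi : Integrable (U.indicator α) := integrable_indicator_of_bounded hU
    (hUS.trans sdiff_subset) hbdd (hα.mono hUS) fun s hs => hM s (hUS hs)
  let τ : ℕ → ℝ := fun n => 1 / ((n : ℝ) + 1)
  have hτ0 : ∀ n, 0 < τ n := fun n => Nat.one_div_pos_of_nat
  have hτ1 : ∀ n, τ n ≤ 1 := fun n => by
    have : (0 : ℝ) ≤ n := n.cast_nonneg
    exact (div_le_one (by linarith)).2 (by linarith)
  have hτ : Filter.Tendsto τ Filter.atTop (𝓝 0) := tendsto_one_div_add_atTop_nhds_zero_nat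
  let y : ℕ → (Fin d → ℝ) → (Fin d → ℝ) := fun n z => (1 - τ n) • z + τ n • p
  let φ : ℕ → ContDiffBump (0 : Fin d → ℝ) := fun n =>
    ⟨r * τ n / 4, r * τ n / 2, by have := mul_pos hr (hτ0 n); linarith,
      by have := mul_pos hr (hτ0 n); linarith⟩
  have hφr : ∀ n, (φ n).rOut = r * τ n / 2 := fun n => rfl
  let F : ℕ → (Fin d → ℝ) → ℝ := fun n =>
    convolution ((φ n).normed volume) (U.indicator α) (ContinuousLinearMap.lsmul ℝ ℝ) volume
  have hF : ∀ n, ContDiff ℝ ∞ (F n) := fun n =>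
    (φ n).hasCompactSupport_normed.contDiff_convolution_left (n := ⊤) _ (φ n).contDiff_normed
      hfi.locallyIntegrable
  obtain ⟨R, hR⟩ : ∃ R, ∀ z ∈ S, ‖p - z‖ ≤ R := by
    obtain ⟨R, hR⟩ := hbdd.subset_closedBall p
    exact ⟨R, fun z hz => by rw [← dist_eq_norm, dist_comm]; exact hR hz⟩
  have hR0 : 0 ≤ R := (norm_nonneg _).trans (hR x₀ hx₀)
  -- all points near the contracted point are close to the original one
  have hclose : ∀ n, ∀ z ∈ S, ∀ w ∈ Metric.closedBall (y n z) (φ n).rOut,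
      dist w z ≤ τ n * (R + r) := by
    intro n z hz w hw
    have h1 : dist (y n z) z ≤ τ n * R := by
      have : y n z - z = τ n • (p - z) := by simp only [y]; module
      rw [dist_eq_norm, this, norm_smul, Real.norm_of_nonneg (hτ0 n).le]
      exact mul_le_mul_of_nonneg_left (hR z hz) (hτ0 n).le
    have h2 : dist w (y n z) ≤ r * τ n / 2 := hw
    have := mul_pos hr (hτ0 n)
    linarith [dist_triangle w (y n z) z]
  have hinner : ∀ n, ∀ z ∈ S, Metric.closedBall (y n z) (φ n).rOut ⊆ interior S := by
    intro n z hz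
    refine (Metric.closedBall_subset_ball ?_).trans
      (ball_contraction_subset_interior hS hprS hz (hτ0 n) (hτ1 n))
    rw [hφr]
    linarith [mul_pos hr (hτ0 n)]
  have hsmall : ∀ δ > 0, ∀ᶠ n in Filter.atTop, τ n * (R + r) < δ := fun δ hδ => by
    have : Filter.Tendsto (fun n => τ n * (R + r)) Filter.atTop (𝓝 0) := by
      simpa using hτ.mul_const (R + r)
    exact this.eventually_lt_const hδ
  let A : ℕ → (m : ℕ) → (Fin m → Fin d) → ℝ := fun n m i =>
    if |partialDeriv i (F n) (y n x₀)| ≤ 1 then partialDeriv i (F n) (y n x₀) else 0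
  let box : Set ((m : ℕ) → (Fin m → Fin d) → ℝ) :=
    univ.pi fun m => univ.pi fun _ => Icc (-1) 1
  have hbox : IsCompact box :=
    isCompact_univ_pi fun m => isCompact_univ_pi fun _ => isCompact_Icc
  have hA : ∀ n, A n ∈ box := fun n m _ i _ => by
    simp only [A]
    split_ifs with h
    · exact abs_le.1 h
    · simp
  obtain ⟨a, ha, θ, hθ, hlim⟩ := hbox.tendsto_subseq hA
  refine ⟨a, fun n i => abs_le.2 (ha n trivial i trivial), fun x hx hseg => ?_⟩
  have hsegS : segment ℝ x₀ x ⊆ S := hS.segment_subset hx₀ hx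
  -- the tube around the contracted segment
  have htube : ∀ᶠ n in Filter.atTop, ∀ z ∈ segment ℝ x₀ x,
      Metric.closedBall (y n z) (φ n).rOut ⊆ U := by
    have hdisj : Disjoint (segment ℝ x₀ x) (E : Set (Fin d → ℝ)) :=
      disjoint_left.2 fun z hz he => hseg z he hz
    obtain ⟨δ, hδ, hd⟩ := hdisj.exists_thickenings
      (by rw [segment_eq_image_lineMap]; exact isCompact_Icc.image AffineMap.lineMap_continuous)
      E.finite_toSet.isClosed
    filter_upwards [hsmall δ hδ] with n hn z hz w hw
    refine ⟨hinner n z (hsegS hz) hw, fun he => ?_⟩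
    refine disjoint_left.1 hd (Metric.mem_thickening_iff.2 ⟨z, hz, ?_⟩)
      (Metric.self_subset_thickening hδ _ he)
    exact (hclose n z (hsegS hz) w hw).trans_lt hn
  have htaylor : ∀ᶠ n in Filter.atTop,
      |F n (y n x) - jetPoly k (A n) (y n x - y n x₀)| ≤ (d : ℝ) ^ k * ‖y n x - y n x₀‖ ^ k := by
    filter_upwards [htube] with n hn
    have hb := abs_sub_jetPoly_le hk (hF n) (y n x₀) (y n x) (fun w hw i => by
      have hw' : ∃ z ∈ segment ℝ x₀ x, y n z = w := by
        obtain ⟨s, t, hs, ht, hst, rfl⟩ := hw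
        refine ⟨s • x₀ + t • x, ⟨s, t, hs, ht, hst, rfl⟩, ?_⟩
        simp only [y]
        obtain rfl : s = 1 - t := by linarith
        module
      obtain ⟨z, hz, rfl⟩ := hw'
      exact abs_partialDeriv_mollify_le hU hW hfi.locallyIntegrable (φ n) (hn z hz) le_rfl i)
    have hjet : jetPoly k (A n) (y n x - y n x₀) =
        jetPoly k (fun _ i => partialDeriv i (F n) (y n x₀)) (y n x - y n x₀) := by
      refine Finset.sum_congr rfl fun m hm => ?_
      congr 1
      refine Finset.sum_congr rfl fun i _ => ?_
      rw [show A n m i = partialDeriv i (F n) (y n x₀) from if_pos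
        (abs_partialDeriv_mollify_le hU hW hfi.locallyIntegrable (φ n)
          (hn x₀ (left_mem_segment ℝ x₀ x)) (Finset.mem_range.1 hm).le i)]
    rw [hjet]
    exact hb
  have hxE : x ∈ S \ E := ⟨hx, fun he => hseg x he (right_mem_segment ℝ x₀ x)⟩
  have hconv : Filter.Tendsto (fun n => F n (y n x)) Filter.atTop (𝓝 (α x)) := by
    rw [Metric.tendsto_atTop']
    intro ε hε
    obtain ⟨δ, hδ, hcont⟩ := Metric.continuousWithinAt_iff.1 (hα x hxE) (ε / 2) (half_pos hε)
    obtain ⟨N, hN⟩ := Filter.eventually_atTop.1 ((hsmall δ hδ).and htube)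
    refine ⟨N, fun n hn => ?_⟩
    obtain ⟨h1, h2⟩ := hN n hn.le
    refine lt_of_le_of_lt ?_ (half_lt_self hε)
    refine dist_convolution_le (half_pos hε).le (φ n).support_normed_eq.subset
      (φ n).nonneg_normed (φ n).integral_normed hfi.aestronglyMeasurable fun w hw => ?_
    have hwU : w ∈ U := h2 x (right_mem_segment ℝ x₀ x) (Metric.ball_subset_closedBall hw)
    rw [indicator_of_mem hwU]
    exact (hcont (hUS hwU)
      ((hclose n x hx w (Metric.ball_subset_closedBall hw)).trans_lt h1)).le
  have hy : ∀ z, Filter.Tendsto (fun n => y n z) Filter.atTop (𝓝 z) := fun z => by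
    have := ((hτ.const_sub 1).smul_const z).add (hτ.smul_const p)
    simpa using! this
  have hdiff : Filter.Tendsto (fun n => y n x - y n x₀) Filter.atTop (𝓝 (x - x₀)) :=
    (hy x).sub (hy x₀)
  have hθ' := hθ.tendsto_atTop
  have hl : Filter.Tendsto (fun n => |F (θ n) (y (θ n) x) -
      jetPoly k (A (θ n)) (y (θ n) x - y (θ n) x₀)|) Filter.atTop
      (𝓝 |α x - jetPoly k a (x - x₀)|) :=
    ((hconv.comp hθ').sub (((continuous_jetPoly k).tendsto (a, x - x₀)).comp
      (hlim.prodMk_nhds (hdiff.comp hθ')))).abs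
  refine le_of_tendsto_of_tendsto hl ((((hdiff.comp hθ').norm).pow k).const_mul _) ?_
  exact hθ'.eventually htaylor

theorem subset_closure_of_ae {d : ℕ} {S : Set (Fin d → ℝ)} (hS : Convex ℝ S)
    (hint : (interior S).Nonempty) {q : (Fin d → ℝ) → Prop} (hq : ∀ᵐ x, q x) :
    S ⊆ closure {x | x ∈ S ∧ q x} := by
  have hd : Dense {x | q x} := Measure.dense_of_ae hq
  have h1 : S ⊆ closure (interior S) := by
    rw [hS.closure_interior_eq_closure_of_nonempty_interior hint]
    exact subset_closure
  refine h1.trans (closure_minimal ((hd.open_subset_closure_inter isOpen_interior).trans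
    (closure_mono ?_)) isClosed_closure)
  exact fun x hx => ⟨interior_subset hx.1, hx.2⟩

/-- In dimension at least two, almost every segment from a point avoids a given finite set, as the
lines through the point and the points of the set are null sets. -/
theorem ae_notMem_segment {d : ℕ} {E : Finset (Fin d → ℝ)} (hd : 2 ≤ d ∨ E = ∅)
    {x₀ : Fin d → ℝ} (hx₀ : x₀ ∉ E) : ∀ᵐ x, ∀ e ∈ E, e ∉ segment ℝ x₀ x := by
  rcases hd with hd | rfl
  · rw [Finset.eventually_all]
    intro e he
    have hne : e ≠ x₀ := fun h => hx₀ (h ▸ he)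
    have hnull : volume ((line[ℝ, x₀, e] : AffineSubspace ℝ (Fin d → ℝ)) : Set (Fin d → ℝ)) = 0 := by
      refine Measure.addHaar_affineSubspace _ _ fun htop => ?_
      have h1 : Module.finrank ℝ (line[ℝ, x₀, e]).direction ≤ 1 := by
        rw [direction_affineSpan, vectorSpan_pair_rev]
        exact finrank_span_le_card _ |>.trans (by simp)
      rw [htop, AffineSubspace.direction_top, finrank_top, Module.finrank_fintype_fun_eq_card,
        Fintype.card_fin] at h1
      omega
    refine measure_mono_null (fun x hx => ?_) hnull
    simp only [mem_compl_iff, mem_ofPred_eq, not_not] at hx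
    rw [segment_eq_image_lineMap] at hx
    obtain ⟨t, -, rfl⟩ := hx
    have ht : t ≠ 0 := fun h => hne (by simp [h])
    have : x = AffineMap.lineMap x₀ (AffineMap.lineMap x₀ x t) t⁻¹ := by
      simp only [AffineMap.lineMap_apply, vsub_eq_sub, vadd_eq_add, add_sub_cancel_right, smul_smul,
        inv_mul_cancel₀ ht, one_smul, sub_add_cancel]
    have hmem : AffineMap.lineMap x₀ (AffineMap.lineMap x₀ x t : Fin d → ℝ) t⁻¹ ∈
        line[ℝ, x₀, (AffineMap.lineMap x₀ x t : Fin d → ℝ)] :=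
      AffineMap.lineMap_mem_affineSpan_pair _ _ _
    rw [← this] at hmem
    exact hmem
  · simp

theorem SobolevNormLE.mono_order {d k k' : ℕ} {U : Set (Fin d → ℝ)} {f : (Fin d → ℝ) → ℝ} {M : ℝ}
    (h : SobolevNormLE k U f M) (hk : k' ≤ k) : SobolevNormLE k' U f M :=
  fun n hn => h n (hn.trans hk)

/-- In dimension at least two, finitely many points are removable for `W^{k,∞}`: the function
extends continuously, with Taylor polynomials on the whole convex set. -/
theorem exists_extension {d k : ℕ} (hd1 : 1 ≤ d) (hk : 1 ≤ k) {S : Set (Fin d → ℝ)}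
    (hS : Convex ℝ S) (hint : (interior S).Nonempty) (hbdd : Bornology.IsBounded S)
    {E : Finset (Fin d → ℝ)} (hd : 2 ≤ d ∨ E = ∅) {α : (Fin d → ℝ) → ℝ}
    (hα : ContinuousOn α (S \ E)) {A₀ A₁ : ℝ} (hJ : ∀ s ∈ S \ E, α s ∈ Icc A₀ A₁)
    (hW : SobolevNormLE k (interior S \ E) α 1) :
    ∃ β : (Fin d → ℝ) → ℝ, (∀ s ∈ S \ E, β s = α s) ∧ (∀ s ∈ S, β s ∈ Icc A₀ A₁) ∧
      S ⊆ closure (S \ E) ∧ ∀ x₀ ∈ S \ E, ∃ a : (n : ℕ) → (Fin n → Fin d) → ℝ, (∀ n i, |a n i| ≤ 1) ∧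
        ∀ x ∈ S, |β x - jetPoly k a (x - x₀)| ≤ (d : ℝ) ^ k * ‖x - x₀‖ ^ k := by
  have hM : ∀ s ∈ S \ E, |α s| ≤ max |A₀| |A₁| := fun s hs =>
    abs_le_max_abs_abs (hJ s hs).1 (hJ s hs).2
  have hjet : ∀ m, 1 ≤ m → m ≤ k → ∀ x₀ ∈ S \ E,
      ∃ a : (n : ℕ) → (Fin n → Fin d) → ℝ, (∀ n i, |a n i| ≤ 1) ∧
        ∀ x ∈ S \ E, |α x - jetPoly m a (x - x₀)| ≤ (d : ℝ) ^ m * ‖x - x₀‖ ^ m := by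
    intro m hm hmk x₀ hx₀
    obtain ⟨a, ha, h⟩ := exists_jet hm hS hint hbdd hα hM (hW.mono_order hmk) hx₀.1
    refine ⟨a, ha, fun x hx => ?_⟩
    have hcl := subset_closure_of_ae hS hint (ae_notMem_segment hd hx₀.2) hx.1
    have hsub : {x | x ∈ S ∧ ∀ e ∈ E, e ∉ segment ℝ x₀ x} ⊆ S \ E := fun z hz =>
      ⟨hz.1, fun he => hz.2 z he (right_mem_segment ℝ x₀ z)⟩
    have hc : Continuous fun z => jetPoly m a (z - x₀) :=
      (continuous_jetPoly m).comp (continuous_const.prodMk (continuous_id.sub continuous_const))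
    refine ContinuousWithinAt.closure_le hcl
      (((hα x hx).mono hsub).sub hc.continuousWithinAt).abs ?_ fun z hz => h z hz.1 hz.2
    exact Continuous.continuousWithinAt (by fun_prop)
  have hlip : LipschitzOnWith d α (S \ E) := by
    refine LipschitzOnWith.of_dist_le_mul fun x hx x₀ hx₀ => ?_
    obtain ⟨a, -, h⟩ := hjet 1 le_rfl hk x₀ hx₀
    have h0 : ∀ v : Fin d → ℝ, jetPoly 1 a v = jetPoly 1 a 0 := fun v => by simp [jetPoly]
    have h1 : α x₀ = jetPoly 1 a 0 := by
      have := h x₀ hx₀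
      simpa [sub_eq_zero] using this
    have h2 := h x hx
    rw [h0, ← h1, pow_one, pow_one] at h2
    rw [Real.dist_eq, dist_eq_norm]
    exact_mod_cast h2
  obtain ⟨β, hβ, hEq⟩ := hlip.extend_real
  have hdense : S ⊆ closure (S \ E) := by
    have : Nonempty (Fin d) := ⟨⟨0, hd1⟩⟩
    have : ∀ᵐ x : Fin d → ℝ, x ∉ (E : Set (Fin d → ℝ)) :=
      measure_eq_zero_iff_ae_notMem.1 (E.finite_toSet.measure_zero _)
    exact subset_closure_of_ae hS hint this
  refine ⟨β, fun s hs => (hEq hs).symm, fun s hs => ?_, hdense, fun x₀ hx₀ => ?_⟩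
  · refine closure_minimal (t := β ⁻¹' Icc A₀ A₁) (fun z hz => ?_)
      (isClosed_Icc.preimage hβ.continuous) (hdense hs)
    rw [mem_preimage, ← hEq hz]
    exact hJ z hz
  · obtain ⟨a, ha, h⟩ := hjet k hk le_rfl x₀ hx₀
    refine ⟨a, ha, fun x hx => ?_⟩
    have hc : Continuous fun z => jetPoly k a (z - x₀) :=
      (continuous_jetPoly k).comp (continuous_const.prodMk (continuous_id.sub continuous_const))
    have hr : Continuous fun z => (d : ℝ) ^ k * ‖z - x₀‖ ^ k := by fun_prop
    have hl : Continuous fun z => |β z - jetPoly k a (z - x₀)| := (hβ.continuous.sub hc).abs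
    refine ContinuousWithinAt.closure_le (hdense hx) hl.continuousWithinAt hr.continuousWithinAt
      fun z hz => ?_
    rw [← hEq hz]
    exact h z hz

/-! ### Building networks unit by unit -/

/-- `f` is an affine combination of `t` members of `L` in layers at most `ℓ`. The set `L` consists
of functions paired with the layers in which they are computed. -/
inductive AffComb {d : ℕ} (L : Set (((Fin d → ℝ) → ℝ) × ℕ)) (ℓ : ℕ) :
    ℕ → ((Fin d → ℝ) → ℝ) → Prop
  | const (t : ℕ) (b : ℝ) : AffComb L ℓ t (fun _ => b)
  | add {t : ℕ} {f g : (Fin d → ℝ) → ℝ} {j : ℕ} (w : ℝ) : AffComb L ℓ t f → (g, j) ∈ L → j ≤ ℓ →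
      AffComb L ℓ (t + 1) (fun x => f x + w * g x)

/-- `L'` arises from `L` by adding hidden units in layers at most `D`, of total cost at most `n`,
where a unit of fan-in `t` costs `t + 1`. Units are identified with the functions they compute. -/
inductive Extends {d : ℕ} (D : ℕ) (L : Set (((Fin d → ℝ) → ℝ) × ℕ)) :
    Set (((Fin d → ℝ) → ℝ) × ℕ) → ℕ → Prop
  | refl : Extends D L L 0
  | unit {L' : Set (((Fin d → ℝ) → ℝ) × ℕ)} {n t ℓ : ℕ} {f : (Fin d → ℝ) → ℝ} :
      Extends D L L' n → AffComb L' ℓ t f → ℓ + 1 ≤ D →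
      Extends D L (insert (fun x => max 0 (f x), ℓ + 1) L') (n + (t + 1))
  | mono {L' : Set (((Fin d → ℝ) → ℝ) × ℕ)} {n n' : ℕ} :
      Extends D L L' n → n ≤ n' → Extends D L L' n'

/-- The input units, in layer `0`. -/
def inputs (d : ℕ) : Set (((Fin d → ℝ) → ℝ) × ℕ) := range fun a => (fun x => x a, 0)

namespace ReLUNetwork

variable {d : ℕ}

/-- The network with no hidden units. -/
def empty (d : ℕ) : ReLUNetwork d where
  units := 0
  layer := Fin.elim0
  sources := Fin.elim0
  weight := Fin.elim0
  bias := Fin.elim0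
  outSources := ∅
  outWeight := 0
  outBias := 0
  layer_pos := fun i => i.elim0
  feedForward := fun i => i.elim0

/-- The units of a network as units of a network with one more hidden unit. -/
def liftUnit (d u : ℕ) : Fin d ⊕ Fin u ↪ Fin d ⊕ Fin (u + 1) :=
  (Function.Embedding.refl _).sumMap Fin.castSuccEmb

/-- A family of weights, continued by `0` to one more hidden unit. -/
def liftWeight {u : ℕ} (w : Fin d ⊕ Fin u → ℝ) : Fin d ⊕ Fin (u + 1) → ℝ :=
  Sum.elim (fun a => w (.inl a)) (Fin.snoc (α := fun _ => ℝ) (fun j => w (.inr j)) 0)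

@[simp] theorem liftWeight_liftUnit {u : ℕ} (w : Fin d ⊕ Fin u → ℝ) (p : Fin d ⊕ Fin u) :
    liftWeight w (liftUnit d u p) = w p := by
  rcases p with a | j
  · rfl
  · exact Fin.snoc_castSucc (α := fun _ => ℝ) 0 (fun j => w (.inr j)) j

/-- The layer of an input or hidden unit. -/
def unitLayer (N : ReLUNetwork d) : Fin d ⊕ Fin N.units → ℕ := Sum.elim (fun _ => 0) N.layer

/-- The network `N` with one more hidden unit, in layer `ℓ + 1`. -/
abbrev snoc (N : ReLUNetwork d) (ℓ : ℕ) (A : Finset (Fin d ⊕ Fin N.units))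
    (w : Fin d ⊕ Fin N.units → ℝ) (b : ℝ) (hA : ∀ p ∈ A, N.unitLayer p ≤ ℓ) : ReLUNetwork d where
  units := N.units + 1
  layer := Fin.snoc (α := fun _ => ℕ) N.layer (ℓ + 1)
  sources := Fin.snoc (α := fun _ => Finset (Fin d ⊕ Fin (N.units + 1)))
    (fun i => (N.sources i).map (liftUnit d N.units)) (A.map (liftUnit d N.units))
  weight := Fin.snoc (α := fun _ => Fin d ⊕ Fin (N.units + 1) → ℝ)
    (fun i => liftWeight (N.weight i)) (liftWeight w)
  bias := Fin.snoc (α := fun _ => ℝ) N.bias b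
  outSources := ∅
  outWeight := 0
  outBias := 0
  layer_pos := by
    refine Fin.lastCases ?_ fun i => ?_
    · simp
    · simpa using N.layer_pos i
  feedForward := by
    refine Fin.lastCases ?_ fun i => ?_
    · intro j hj
      simp only [Fin.snoc_last, Finset.mem_map] at hj
      obtain ⟨p | p, hp, h⟩ := hj
      · simp [liftUnit] at h
      · have h' : p.castSucc = j := by simpa [liftUnit] using h
        subst h'
        have := hA _ hp
        simp only [Fin.snoc_castSucc, Fin.snoc_last]
        exact Nat.lt_succ_of_le this
    · intro j hj
      simp only [Fin.snoc_castSucc, Finset.mem_map] at hj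
      obtain ⟨p | p, hp, h⟩ := hj
      · simp [liftUnit] at h
      · have h' : p.castSucc = j := by simpa [liftUnit] using h
        subst h'
        simpa using N.feedForward i p hp

section snoc

variable (N : ReLUNetwork d) (ℓ : ℕ) (A : Finset (Fin d ⊕ Fin N.units))
  (w : Fin d ⊕ Fin N.units → ℝ) (b : ℝ) (hA : ∀ p ∈ A, N.unitLayer p ≤ ℓ)

theorem snoc_value_castSucc (x : Fin d → ℝ) (i : Fin N.units) :
    (N.snoc ℓ A w b hA).value x (Fin.castSucc i : Fin (N.units + 1)) = N.value x i := by
  induction h : N.layer i using Nat.strong_induction_on generalizing i with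
  | _ n ih =>
    rw [value_eq, value_eq N]
    have h1 : (N.snoc ℓ A w b hA).sources (Fin.castSucc i : Fin (N.units + 1)) =
      (N.sources i).map (liftUnit d N.units) :=
        Fin.snoc_castSucc (α := fun _ => Finset (Fin d ⊕ Fin (N.units + 1)))
          (A.map (liftUnit d N.units)) (fun i => (N.sources i).map (liftUnit d N.units)) i
    have h2 : (N.snoc ℓ A w b hA).weight (Fin.castSucc i : Fin (N.units + 1)) =
      liftWeight (N.weight i) :=
        Fin.snoc_castSucc (α := fun _ => Fin d ⊕ Fin (N.units + 1) → ℝ)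
          (liftWeight w) (fun i => liftWeight (N.weight i)) i
    have h3 : (N.snoc ℓ A w b hA).bias (Fin.castSucc i : Fin (N.units + 1)) = N.bias i :=
      Fin.snoc_castSucc (α := fun _ => ℝ) b N.bias i
    rw [h1, h2, h3, Finset.sum_map]
    congr 2
    refine Finset.sum_congr rfl fun p hp => ?_
    rw [liftWeight_liftUnit]
    rcases p with a | j
    · rfl
    · congr 1
      exact ih _ (h ▸ N.feedForward i j hp) j rfl

theorem snoc_elim_liftUnit (x : Fin d → ℝ) (p : Fin d ⊕ Fin N.units) :
    Sum.elim x ((N.snoc ℓ A w b hA).value x) (liftUnit d N.units p) =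
      Sum.elim x (N.value x) p := by
  rcases p with a | j
  · rfl
  · exact N.snoc_value_castSucc ℓ A w b hA x j

theorem snoc_value_last (x : Fin d → ℝ) :
    (N.snoc ℓ A w b hA).value x (Fin.last N.units) =
      max 0 (∑ p ∈ A, w p * Sum.elim x (N.value x) p + b) := by
  rw [value_eq]
  have h1 : (N.snoc ℓ A w b hA).sources (Fin.last N.units) = A.map (liftUnit d N.units) :=
    Fin.snoc_last (α := fun _ => Finset (Fin d ⊕ Fin (N.units + 1)))
      (A.map (liftUnit d N.units)) (fun i => (N.sources i).map (liftUnit d N.units))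
  have h2 : (N.snoc ℓ A w b hA).weight (Fin.last N.units) = liftWeight w :=
    Fin.snoc_last (α := fun _ => Fin d ⊕ Fin (N.units + 1) → ℝ)
      (liftWeight w) (fun i => liftWeight (N.weight i))
  have h3 : (N.snoc ℓ A w b hA).bias (Fin.last N.units) = b :=
    Fin.snoc_last (α := fun _ => ℝ) b N.bias
  rw [h1, h2, h3, Finset.sum_map]
  congr 2
  refine Finset.sum_congr rfl fun p _ => ?_
  rw [liftWeight_liftUnit, snoc_elim_liftUnit]

end snoc

end ReLUNetwork

open ReLUNetwork

/-- The network `N` computes the members of `L` in the layers that `L` prescribes. -/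
def Implements {d : ℕ} (N : ReLUNetwork d) (L : Set (((Fin d → ℝ) → ℝ) × ℕ)) : Prop :=
  ∀ q ∈ L, ∃ p : Fin d ⊕ Fin N.units, N.unitLayer p = q.2 ∧
    ∀ x, Sum.elim x (N.value x) p = q.1 x

/-- Repeated sources are merged by adding their weights, so that the number of connections is at
most the length of the combination. -/
theorem AffComb.exists_weights {d : ℕ} {L : Set (((Fin d → ℝ) → ℝ) × ℕ)} {ℓ t : ℕ}
    {f : (Fin d → ℝ) → ℝ} (hf : AffComb L ℓ t f) {N : ReLUNetwork d} (hN : Implements N L) :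
    ∃ (w : (Fin d ⊕ Fin N.units) →₀ ℝ) (b : ℝ), w.support.card ≤ t ∧
      (∀ p ∈ w.support, N.unitLayer p ≤ ℓ) ∧
      ∀ x, f x = ∑ p ∈ w.support, w p * Sum.elim x (N.value x) p + b := by
  classical
  induction hf with
  | const t b => exact ⟨0, b, by simp, by simp, by simp⟩
  | @add t f g j v _ hg hj ih =>
    obtain ⟨w, b, hw, hl, hx⟩ := ih
    obtain ⟨p, hp, hpx⟩ := hN _ hg
    refine ⟨w + Finsupp.single p v, b, ?_, fun q hq => ?_, fun x => ?_⟩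
    · calc (w + Finsupp.single p v).support.card
          ≤ (w.support ∪ (Finsupp.single p v).support).card :=
            Finset.card_le_card Finsupp.support_add
        _ ≤ w.support.card + (Finsupp.single p v).support.card := Finset.card_union_le _ _
        _ ≤ t + 1 := by
            gcongr
            exact (Finset.card_le_card Finsupp.support_single_subset).trans (by simp)
    · rcases Finset.mem_union.1 (Finsupp.support_add hq) with h | h
      · exact hl q h
      · obtain rfl := Finset.mem_singleton.1 (Finsupp.support_single_subset h)
        exact hp.trans_le hj
    · have h1 : ∑ q ∈ (w + Finsupp.single p v).support,
          (w + Finsupp.single p v) q * Sum.elim x (N.value x) q =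
          (w + Finsupp.single p v).sum fun q a => a * Sum.elim x (N.value x) q := rfl
      rw [h1, Finsupp.sum_add_index' (by simp) (by intros; ring), Finsupp.sum_single_index (by simp),
        hpx x, Finsupp.sum]
      show f x + v * g x = _
      rw [hx x]
      ring

/-- Units added one by one form a network. -/
theorem Extends.exists_network {d D n : ℕ} {L : Set (((Fin d → ℝ) → ℝ) × ℕ)}
    (h : Extends D (inputs d) L n) :
    ∃ N : ReLUNetwork d, (∀ i, N.layer i ≤ D) ∧ ∑ i, (N.sources i).card + N.units ≤ n ∧
      Implements N L := by
  induction h with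
  | refl =>
    refine ⟨empty d, fun i => i.elim0, by simp [empty], ?_⟩
    rintro _ ⟨a, rfl⟩
    exact ⟨.inl a, rfl, fun x => rfl⟩
  | mono _ hn ih =>
    obtain ⟨N, h1, h2, h3⟩ := ih
    exact ⟨N, h1, h2.trans hn, h3⟩
  | @unit L' n t ℓ f _ hf hℓ ih =>
    obtain ⟨N, h1, h2, h3⟩ := ih
    obtain ⟨w, b, hw, hl, hx⟩ := hf.exists_weights h3
    refine ⟨N.snoc ℓ w.support w b hl, ?_, ?_, ?_⟩
    · show ∀ i : Fin (N.units + 1), Fin.snoc (α := fun _ => ℕ) N.layer (ℓ + 1) i ≤ D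
      refine Fin.lastCases ?_ fun i => ?_
      · simpa using hℓ
      · simpa using h1 i
    · have : ∑ i, ((N.snoc ℓ w.support w b hl).sources i).card =
          ∑ i, (N.sources i).card + w.support.card := by
        show ∑ i : Fin (N.units + 1), (Fin.snoc (α := fun _ => Finset (Fin d ⊕ Fin (N.units + 1)))
          (fun i => (N.sources i).map (liftUnit d N.units))
          (w.support.map (liftUnit d N.units)) i).card = _
        rw [Fin.sum_univ_castSucc]
        simp
      rw [this]
      show _ + (N.units + 1) ≤ _
      omega
    · intro q hq
      rcases hq with rfl | hq
      · refine ⟨.inr (Fin.last N.units), ?_, fun x => ?_⟩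
        · exact Fin.snoc_last (α := fun _ => ℕ) _ _
        · rw [Sum.elim_inr, snoc_value_last, ← hx]
      · obtain ⟨p, hp, hpx⟩ := h3 q hq
        refine ⟨liftUnit d N.units p, ?_, fun x => ?_⟩
        · rw [← hp]
          rcases p with a | j
          · rfl
          · exact Fin.snoc_castSucc (α := fun _ => ℕ) _ _ _
        · rw [snoc_elim_liftUnit, hpx]

/-- A function reached by adding units to the inputs is computed by a network. -/
theorem Extends.exists_eval_eq {d D n ℓ t : ℕ} {L : Set (((Fin d → ℝ) → ℝ) × ℕ)}
    {f : (Fin d → ℝ) → ℝ} (h : Extends D (inputs d) L n) (hf : AffComb L ℓ t f) :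
    ∃ F : ReLUNetwork d, F.depth ≤ D + 2 ∧ F.size ≤ n + t + 1 ∧ ∀ x, F.eval x = f x := by
  obtain ⟨N, h1, h2, h3⟩ := h.exists_network
  obtain ⟨w, b, hw, -, hx⟩ := hf.exists_weights h3
  let F : ReLUNetwork d := { N with outSources := w.support, outWeight := w, outBias := b }
  have hv : ∀ x i, F.value x i = N.value x i := by
    intro x i
    induction h : N.layer i using Nat.strong_induction_on generalizing i with
    | _ m ih =>
      rw [value_eq, value_eq N]
      show max 0 (∑ p ∈ N.sources i, N.weight i p * Sum.elim x (F.value x) p + N.bias i) = _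
      congr 2
      refine Finset.sum_congr rfl fun p hp => ?_
      rcases p with a | j
      · rfl
      · congr 1
        exact ih _ (h ▸ N.feedForward i j hp) j rfl
  refine ⟨F, ?_, ?_, fun x => ?_⟩
  · have : Finset.univ.sup F.layer ≤ D := Finset.sup_le fun i _ => h1 i
    exact Nat.add_le_add_right this 2
  · show (∑ i, (N.sources i).card + w.support.card) + (N.units + 1) ≤ _
    omega
  · have hvx : F.value x = N.value x := funext (hv x)
    rw [hx x, eval, hvx]

/-! ### Affine combinations of units and piecewise linear nodal functions -/

section calculus

variable {d : ℕ} {D ℓ ℓ' t t' n n' : ℕ} {L L' L'' : Set (((Fin d → ℝ) → ℝ) × ℕ)}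
  {f g : (Fin d → ℝ) → ℝ}

theorem AffComb.mono (hf : AffComb L ℓ t f) (hL : L ⊆ L') (hℓ : ℓ ≤ ℓ') (ht : t ≤ t') :
    AffComb L' ℓ' t' f := by
  induction hf generalizing t' with
  | const t b => exact .const _ b
  | @add t f g j w _ hg hj ih =>
    obtain ⟨s, rfl⟩ : ∃ s, t' = s + 1 := ⟨t' - 1, by omega⟩
    exact .add w (ih (by omega)) (hL hg) (hj.trans hℓ)

theorem AffComb.congr (hf : AffComb L ℓ t f) (h : ∀ x, f x = g x) : AffComb L ℓ t g :=
  funext h ▸ hf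

theorem AffComb.add_const (hf : AffComb L ℓ t f) (b : ℝ) : AffComb L ℓ t (fun x => f x + b) := by
  induction hf with
  | const t b' => exact .const t (b' + b)
  | @add t f g j w _ hg hj ih =>
    convert AffComb.add w ih hg hj using 2
    ring

theorem AffComb.const_mul (hf : AffComb L ℓ t f) (c : ℝ) : AffComb L ℓ t (fun x => c * f x) := by
  induction hf with
  | const t b' => exact .const t (c * b')
  | @add t f g j w _ hg hj ih =>
    convert AffComb.add (c * w) ih hg hj using 2
    ring

theorem AffComb.add_comb (hf : AffComb L ℓ t f) (hg : AffComb L ℓ t' g) :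
    AffComb L ℓ (t + t') (fun x => f x + g x) := by
  induction hg with
  | const t' b => exact (hf.add_const b).mono subset_rfl le_rfl (Nat.le_add_right _ _)
  | @add t' g' g j w _ hg hj ih =>
    exact (AffComb.add w ih hg hj).congr fun x => by ring

theorem AffComb.of_mem {j : ℕ} (hg : (g, j) ∈ L) (hj : j ≤ ℓ) : AffComb L ℓ 1 g := by
  convert AffComb.add 1 (AffComb.const 0 0) hg hj using 2
  ring

theorem AffComb.sum {ι : Type*} (s : Finset ι) {F : ι → (Fin d → ℝ) → ℝ}
    (hF : ∀ i ∈ s, AffComb L ℓ t (F i)) (w : ι → ℝ) :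
    AffComb L ℓ (s.card * t) (fun x => ∑ i ∈ s, w i * F i x) := by
  classical
  induction s using Finset.induction_on with
  | empty => simpa using AffComb.const 0 0
  | insert a s ha ih =>
    have h1 := (ih fun i hi => hF i (Finset.mem_insert_of_mem hi)).add_comb
      ((hF a (Finset.mem_insert_self a s)).const_mul (w a))
    simp_rw [Finset.sum_insert ha, Finset.card_insert_of_notMem ha]
    refine (h1.mono subset_rfl le_rfl (t' := (s.card + 1) * t) (by rw [Nat.succ_mul])).congr fun x => ?_
    ring

theorem Extends.subset (h : Extends D L L' n) : L ⊆ L' := by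
  induction h with
  | refl => exact subset_rfl
  | unit _ _ _ ih => exact ih.trans (subset_insert _ _)
  | mono _ _ ih => exact ih

theorem Extends.trans (h : Extends D L L' n) (h' : Extends D L' L'' n') :
    Extends D L L'' (n + n') := by
  induction h' with
  | refl => exact h
  | unit _ hf hℓ ih => exact (ih.unit hf hℓ).mono (by omega)
  | mono _ hn ih => exact ih.mono (by omega)

theorem AffComb.exists_relu (hf : AffComb L ℓ t f) (hD : ℓ + 1 ≤ D) :
    ∃ L', Extends D L L' (t + 1) ∧ AffComb L' (ℓ + 1) 1 (fun x => max 0 (f x)) :=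
  ⟨_, (Extends.refl.unit hf hD).mono (by omega), .of_mem (mem_insert _ _) le_rfl⟩

/-- Two units keep the value of an affine combination of large fan-in. -/
theorem AffComb.exists_store (hf : AffComb L ℓ t f) (hD : ℓ + 1 ≤ D) :
    ∃ L', Extends D L L' (2 * (t + 1)) ∧ AffComb L' (ℓ + 1) 2 f := by
  obtain ⟨L₁, h₁, hf₁⟩ := hf.exists_relu hD
  obtain ⟨L₂, h₂, hf₂⟩ := ((hf.const_mul (-1)).mono h₁.subset le_rfl le_rfl).exists_relu hD
  refine ⟨L₂, (h₁.trans h₂).mono (by omega), ?_⟩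
  convert (hf₁.mono h₂.subset le_rfl le_rfl).add_comb (hf₂.const_mul (-1)) using 2 with x
  rcases le_total 0 (f x) with h | h
  · rw [max_eq_right h, max_eq_left (by linarith)]; ring
  · rw [max_eq_left h, max_eq_right (by linarith)]; ring

/-- Finitely many constructions, each possible on top of any extension, can all be carried out. -/
theorem exists_extends_forall {ι : Type*} (s : Finset ι)
    {Q : ι → Set (((Fin d → ℝ) → ℝ) × ℕ) → Prop}
    (hQ : ∀ i L₁ L₂, L₁ ⊆ L₂ → Q i L₁ → Q i L₂)
    (step : ∀ i ∈ s, ∀ L₁, L ⊆ L₁ → ∃ L₂, Extends D L₁ L₂ n ∧ Q i L₂) :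
    ∃ L', Extends D L L' (s.card * n) ∧ ∀ i ∈ s, Q i L' := by
  classical
  induction s using Finset.induction_on with
  | empty => exact ⟨L, by simpa using Extends.refl, by simp⟩
  | insert a s ha ih =>
    obtain ⟨L₁, h₁, hq₁⟩ := ih fun i hi => step i (Finset.mem_insert_of_mem hi)
    obtain ⟨L₂, h₂, hq₂⟩ := step a (Finset.mem_insert_self a s) L₁ h₁.subset
    refine ⟨L₂, (h₁.trans h₂).mono ?_, ?_⟩
    · rw [Finset.card_insert_of_notMem ha, Nat.succ_mul]
    · intro i hi
      rcases Finset.mem_insert.1 hi with rfl | hi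
      · exact hq₂
      · exact hQ i _ _ h₂.subset (hq₁ i hi)

end calculus

/-- The maximum of `0` and the coordinates `z i`, `i ∈ s`. -/
def posSup {d : ℕ} (s : Finset (Fin d)) (z : Fin d → ℝ) : ℝ :=
  ((s.sup fun i => (z i).toNNReal : NNReal) : ℝ)

theorem posSup_nonneg {d : ℕ} (s : Finset (Fin d)) (z : Fin d → ℝ) : 0 ≤ posSup s z :=
  NNReal.coe_nonneg _

theorem posSup_insert {d : ℕ} (a : Fin d) (s : Finset (Fin d)) (z : Fin d → ℝ) :
    posSup (insert a s) z = posSup s z + max 0 (z a - posSup s z) := by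
  have h0 := posSup_nonneg s z
  have h : posSup (insert a s) z = max (max (z a) 0) (posSup s z) := by
    rw [posSup, Finset.sup_insert, NNReal.coe_max, Real.coe_toNNReal']
    rfl
  rw [h]
  rcases le_total (z a) (posSup s z) with h1 | h1
  · rw [max_eq_right (max_le h1 h0), max_eq_left (by linarith), add_zero]
  · rw [max_eq_left (h0.trans h1), max_eq_left h1, max_eq_right (by linarith)]
    ring

theorem posSup_univ_le_iff {d : ℕ} {z : Fin d → ℝ} {r : ℝ} (hr : 0 ≤ r) :
    posSup Finset.univ z ≤ r ↔ ∀ i, z i ≤ r := by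
  lift r to NNReal using hr
  rw [posSup, NNReal.coe_le_coe, Finset.sup_le_iff]
  simp [Real.toNNReal_le_iff_le_coe]

theorem le_posSup_univ {d : ℕ} (z : Fin d → ℝ) (i : Fin d) : z i ≤ posSup Finset.univ z :=
  (posSup_univ_le_iff (posSup_nonneg _ _)).1 le_rfl i

theorem posSup_univ_lt_iff {d : ℕ} {z : Fin d → ℝ} {r : ℝ} (hr : 0 < r) :
    posSup Finset.univ z < r ↔ ∀ i, z i < r := by
  refine ⟨fun h i => (le_posSup_univ z i).trans_lt h, fun h => ?_⟩
  lift r to NNReal using hr.le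
  rw [posSup, NNReal.coe_lt_coe, Finset.sup_lt_iff (by simpa using hr)]
  intro i _
  rw [← NNReal.coe_lt_coe, Real.coe_toNNReal']
  exact max_lt (h i) hr

/-- The nodal function of the origin for the Kuhn triangulation of `ℝ^d` with vertex set `ℤ^d`:
one minus the oscillation of `(0, z_1, …, z_d)`, cut off at `0`. -/
def hat {d : ℕ} (z : Fin d → ℝ) : ℝ :=
  max 0 (1 - posSup Finset.univ z - posSup Finset.univ (-z))

theorem hat_nonneg {d : ℕ} (z : Fin d → ℝ) : 0 ≤ hat z := le_max_left _ _

theorem hat_le_one {d : ℕ} (z : Fin d → ℝ) : hat z ≤ 1 :=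
  max_le zero_le_one (by linarith [posSup_nonneg Finset.univ z, posSup_nonneg Finset.univ (-z)])

theorem hat_zero {d : ℕ} : hat (0 : Fin d → ℝ) = 1 := by
  have h : posSup Finset.univ (0 : Fin d → ℝ) = 0 :=
    le_antisymm ((posSup_univ_le_iff le_rfl).2 fun _ => le_rfl) (posSup_nonneg _ _)
  simp [hat, h]

theorem abs_lt_one_of_hat_ne_zero {d : ℕ} {z : Fin d → ℝ} (h : hat z ≠ 0) (i : Fin d) :
    |z i| < 1 := by
  by_contra! hz
  refine h (max_eq_left ?_)
  have h1 := le_posSup_univ z i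
  have h2 := le_posSup_univ (-z) i
  have h3 := posSup_nonneg Finset.univ z
  have h4 := posSup_nonneg Finset.univ (-z)
  rw [Pi.neg_apply] at h2
  rcases le_abs.1 hz with h5 | h5 <;> linarith

theorem hat_sub_eq_integral {d : ℕ} (y : Fin d → ℝ) (c : Fin d → ℤ) :
    hat (fun i => y i - c i) =
      ∫ θ in Ico (0 : ℝ) 1, if (fun i => ⌊y i + θ⌋) = c then (1 : ℝ) else 0 := by
  set z : Fin d → ℝ := fun i => y i - c i
  have hset : ∀ θ ∈ Ico (0 : ℝ) 1, (fun i => ⌊y i + θ⌋) = c ↔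
      θ ∈ Ico (posSup Finset.univ (-z)) (1 - posSup Finset.univ z) := by
    intro θ hθ
    have h1 := posSup_univ_le_iff (z := -z) hθ.1
    have h2 := posSup_univ_lt_iff (z := z) (r := 1 - θ) (by linarith [hθ.2])
    rw [mem_Ico, h1, lt_sub_comm, h2, funext_iff, ← forall_and]
    refine forall_congr' fun i => ?_
    simp only [z, Pi.neg_apply]
    rw [Int.floor_eq_iff]
    constructor <;> rintro ⟨h3, h4⟩ <;> constructor <;> linarith
  have hind : EqOn (fun θ : ℝ => if (fun i => ⌊y i + θ⌋) = c then (1 : ℝ) else 0)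
      ((Ico (posSup Finset.univ (-z)) (1 - posSup Finset.univ z)).indicator 1) (Ico 0 1) := by
    intro θ hθ
    simp only [indicator_apply, ← hset θ hθ, Pi.one_apply]
  rw [setIntegral_congr_fun measurableSet_Ico hind, setIntegral_indicator measurableSet_Ico,
    inter_eq_self_of_subset_right, Pi.one_def, setIntegral_const, smul_eq_mul, mul_one,
    Measure.real, Real.volume_Ico, hat, ENNReal.toReal_ofReal', max_comm]
  exact Ico_subset_Ico (posSup_nonneg _ _) (by linarith [posSup_nonneg Finset.univ z])

/-- The nodal functions of `ℤ^d` are a partition of unity: almost surely, the random rounding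
`⌊y + θ⌋` with `θ` uniform in `[0, 1)` hits exactly one lattice point. -/
theorem sum_hat_eq_one {d : ℕ} {y : Fin d → ℝ} {C : Finset (Fin d → ℤ)}
    (hC : ∀ θ ∈ Ico (0 : ℝ) 1, (fun i => ⌊y i + θ⌋) ∈ C) :
    ∑ c ∈ C, hat (fun i => y i - c i) = 1 := by
  have hm : ∀ c : Fin d → ℤ, MeasurableSet {θ : ℝ | (fun i => ⌊y i + θ⌋) = c} := fun c =>
    (measurable_pi_lambda (fun θ : ℝ => fun i => ⌊y i + θ⌋) fun i =>
      Int.measurable_floor.comp (measurable_const_add (y i))) (measurableSet_singleton c)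
  have hi : ∀ c ∈ C, IntegrableOn
      (fun θ : ℝ => if (fun i => ⌊y i + θ⌋) = c then (1 : ℝ) else 0) (Ico 0 1) := fun c _ => by
    refine IntegrableOn.of_bound (by simp) (Measurable.ite (hm c) measurable_const
      measurable_const).aestronglyMeasurable 1 (Filter.Eventually.of_forall fun θ => ?_)
    split_ifs <;> simp
  simp_rw [hat_sub_eq_integral]
  rw [← integral_finsetSum C hi]
  have h1 : EqOn (fun θ : ℝ => ∑ c ∈ C, if (fun i => ⌊y i + θ⌋) = c then (1 : ℝ) else 0)
      (fun _ => 1) (Ico 0 1) := fun θ hθ => by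
    simp only [Finset.sum_ite_eq, if_pos (hC θ hθ)]
  rw [setIntegral_congr_fun measurableSet_Ico h1]
  simp

section circuits

variable {d : ℕ} {D ℓ ℓ' t t' n n' : ℕ} {L : Set (((Fin d → ℝ) → ℝ) × ℕ)}
  {f g : (Fin d → ℝ) → ℝ}

theorem exists_posSup {z : Fin d → (Fin d → ℝ) → ℝ} (hz : ∀ i, AffComb L ℓ t (z i))
    (s : Finset (Fin d)) (hD : ℓ + s.card ≤ D) :
    ∃ L', Extends D L L' (s.card * (t + d + 1)) ∧
      AffComb L' (ℓ + s.card) s.card (fun x => posSup s (fun i => z i x)) := by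
  induction s using Finset.induction_on with
  | empty => exact ⟨L, by simpa using Extends.refl, by simpa [posSup] using AffComb.const 0 0⟩
  | insert a s ha ih =>
    have hs : s.card + 1 ≤ d := by
      rw [← Finset.card_insert_of_notMem ha]
      exact (Finset.card_le_univ _).trans (by simp)
    rw [Finset.card_insert_of_notMem ha] at hD ⊢
    obtain ⟨L₁, h₁, hf₁⟩ := ih (by omega)
    obtain ⟨L₂, h₂, hf₂⟩ := AffComb.exists_relu (D := D)
      (((hz a).mono h₁.subset (Nat.le_add_right ℓ s.card) le_rfl).add_comb (hf₁.const_mul (-1)))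
      (by omega)
    refine ⟨L₂, (h₁.trans h₂).mono ?_, ?_⟩
    · rw [Nat.succ_mul]; omega
    · refine ((hf₁.mono h₂.subset (by omega) le_rfl).add_comb hf₂).congr fun x => ?_
      rw [posSup_insert]
      ring_nf

theorem exists_hat {z : Fin d → (Fin d → ℝ) → ℝ} (hz : ∀ i, AffComb L ℓ t (z i))
    (hD : ℓ + d + 1 ≤ D) :
    ∃ L', Extends D L L' (2 * (d * (t + d + 1)) + (2 * d + 1)) ∧
      AffComb L' (ℓ + d + 1) 1 (fun x => hat (fun i => z i x)) := by
  obtain ⟨L₁, h₁, hf₁⟩ := exists_posSup hz Finset.univ (D := D) (by simp; omega)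
  obtain ⟨L₂, h₂, hf₂⟩ := exists_posSup (L := L₁)
    (fun i => ((hz i).const_mul (-1)).mono h₁.subset le_rfl le_rfl)
    Finset.univ (D := D) (by simp; omega)
  rw [Finset.card_univ, Fintype.card_fin] at h₁ h₂ hf₁ hf₂
  obtain ⟨L₃, h₃, hf₃⟩ := AffComb.exists_relu (D := D) (((hf₁.mono h₂.subset le_rfl
    le_rfl).const_mul (-1)).add_comb (hf₂.const_mul (-1)) |>.add_const 1) (by omega)
  refine ⟨L₃, ((h₁.trans h₂).trans h₃).mono (by omega), ?_⟩
  refine hf₃.congr fun x => ?_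
  simp only [neg_one_mul, hat]
  rw [show (fun i => -z i x) = -fun i => z i x from rfl]
  congr 1
  ring

end circuits

/-! ### Multiplication by iterated tent functions -/

/-- The tent function on `[0, 1]`, written with two ReLU terms. -/
def tent (y : ℝ) : ℝ := 2 * max 0 y - 4 * max 0 (y - 1 / 2)

theorem tent_mem_Icc {y : ℝ} (hy : y ∈ Icc (0 : ℝ) 1) : tent y ∈ Icc (0 : ℝ) 1 := by
  obtain ⟨h0, h1⟩ := hy
  rw [tent, max_eq_right h0]
  rcases le_total y (1 / 2) with h | h
  · rw [max_eq_left (by linarith)]; constructor <;> linarith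
  · rw [max_eq_right (by linarith)]; constructor <;> linarith

/-- The functional equation of `y - y²` under the tent function. -/
theorem sub_sq_eq_tent {y : ℝ} (hy : y ∈ Icc (0 : ℝ) 1) :
    y - y ^ 2 = tent y / 4 + (tent y - tent y ^ 2) / 4 := by
  rw [tent, max_eq_right hy.1]
  rcases le_total y (1 / 2) with h | h
  · rw [max_eq_left (by linarith)]; ring
  · rw [max_eq_right (by linarith)]; ring

/-- The partial sums of the series of iterated tent functions that represents `y - y²`. -/
def tentSum (m : ℕ) (y : ℝ) : ℝ := ∑ s ∈ Finset.range m, tent^[s + 1] y / 4 ^ (s + 1)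

theorem iterate_tent_mem_Icc (m : ℕ) {y : ℝ} (hy : y ∈ Icc (0 : ℝ) 1) :
    tent^[m] y ∈ Icc (0 : ℝ) 1 := by
  induction m with
  | zero => exact hy
  | succ m ih => rw [Function.iterate_succ_apply']; exact tent_mem_Icc ih

theorem sub_sq_eq_tentSum (m : ℕ) {y : ℝ} (hy : y ∈ Icc (0 : ℝ) 1) :
    y - y ^ 2 = tentSum m y + (tent^[m] y - (tent^[m] y) ^ 2) / 4 ^ m := by
  induction m with
  | zero => simp [tentSum]
  | succ m ih =>
    rw [ih, sub_sq_eq_tent (iterate_tent_mem_Icc m hy), tentSum, tentSum, Finset.sum_range_succ,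
      Function.iterate_succ_apply', pow_succ]
    field_simp
    ring

theorem abs_tentSum_sub_le (m : ℕ) {y : ℝ} (hy : y ∈ Icc (0 : ℝ) 1) :
    |tentSum m y - (y - y ^ 2)| ≤ (1 / 4) ^ m / 4 := by
  have h := iterate_tent_mem_Icc m hy
  rw [sub_sq_eq_tentSum m hy, sub_add_cancel_left, abs_neg, abs_div, abs_of_nonneg (by positivity :
    (0 : ℝ) ≤ 4 ^ m), abs_of_nonneg (by nlinarith [h.1, h.2]), one_div, inv_pow, div_eq_mul_inv,
    mul_comm, div_eq_mul_inv]
  gcongr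
  nlinarith [sq_nonneg (tent^[m] y - 1 / 2)]

/-- Multiplication by means of two approximate squares of numbers in `[0, 1]`, for factors bounded
by `M`. -/
def mulApprox (M : ℝ) (m : ℕ) (u v : ℝ) : ℝ :=
  4 * M ^ 2 * (((u + v) / (4 * M) + 1 / 2 - tentSum m ((u + v) / (4 * M) + 1 / 2)) -
    ((u - v) / (4 * M) + 1 / 2 - tentSum m ((u - v) / (4 * M) + 1 / 2))) - 2 * M * v

theorem abs_mulApprox_sub_le {M : ℝ} (hM : 0 < M) (m : ℕ) {u v : ℝ} (hu : |u| ≤ M)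
    (hv : |v| ≤ M) : |mulApprox M m u v - u * v| ≤ 2 * M ^ 2 * (1 / 4) ^ m := by
  obtain ⟨hu1, hu2⟩ := abs_le.1 hu
  obtain ⟨hv1, hv2⟩ := abs_le.1 hv
  have hmem : ∀ w : ℝ, |w| ≤ 2 * M → w / (4 * M) + 1 / 2 ∈ Icc (0 : ℝ) 1 := by
    intro w hw
    obtain ⟨hw1, hw2⟩ := abs_le.1 hw
    have h1 : w / (4 * M) ≤ 1 / 2 := by rw [div_le_iff₀ (by positivity)]; linarith
    have h2 : -(1 / 2) ≤ w / (4 * M) := by rw [le_div_iff₀ (by positivity)]; linarith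
    constructor <;> linarith
  have h1 := abs_tentSum_sub_le m (hmem (u + v) (abs_le.2 ⟨by linarith, by linarith⟩))
  have h2 := abs_tentSum_sub_le m (hmem (u - v) (abs_le.2 ⟨by linarith, by linarith⟩))
  have hid : mulApprox M m u v - u * v = 4 * M ^ 2 *
      ((tentSum m ((u - v) / (4 * M) + 1 / 2) -
        ((u - v) / (4 * M) + 1 / 2 - ((u - v) / (4 * M) + 1 / 2) ^ 2)) -
      (tentSum m ((u + v) / (4 * M) + 1 / 2) -
        ((u + v) / (4 * M) + 1 / 2 - ((u + v) / (4 * M) + 1 / 2) ^ 2))) := by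
    rw [mulApprox]
    field_simp
    ring
  rw [hid, abs_mul, abs_of_nonneg (by positivity : (0 : ℝ) ≤ 4 * M ^ 2)]
  calc 4 * M ^ 2 * |_ - _| ≤ 4 * M ^ 2 * ((1 / 4) ^ m / 4 + (1 / 4) ^ m / 4) := by
        gcongr
        exact (abs_sub _ _).trans (add_le_add h2 h1)
    _ = _ := by ring

section circuits

variable {d : ℕ} {D ℓ : ℕ} {L : Set (((Fin d → ℝ) → ℝ) × ℕ)} {f g : (Fin d → ℝ) → ℝ}

theorem exists_tentSum (m : ℕ) (hf : AffComb L ℓ 4 f) (hD : ℓ + m ≤ D) :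
    ∃ L', Extends D L L' (m * 10) ∧ AffComb L' (ℓ + m) 4 (fun x => tent^[m] (f x)) ∧
      AffComb L' (ℓ + m) (2 * m) (fun x => tentSum m (f x)) := by
  induction m with
  | zero => exact ⟨L, by simpa using Extends.refl, hf, by simpa [tentSum] using AffComb.const 0 0⟩
  | succ m ih =>
    obtain ⟨L₁, h₁, hf₁, hs₁⟩ := ih (by omega)
    obtain ⟨L₂, h₂, hf₂⟩ := hf₁.exists_relu (D := D) (by omega)
    obtain ⟨L₃, h₃, hf₃⟩ := ((hf₁.add_const (-(1 / 2))).mono h₂.subset le_rfl le_rfl).exists_relu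
      (D := D) (by omega)
    have ht : AffComb L₃ (ℓ + m + 1) 2 (fun x => tent^[m + 1] (f x)) :=
      (((hf₂.mono h₃.subset le_rfl le_rfl).const_mul 2).add_comb (hf₃.const_mul (-4))).congr
        fun x => by rw [Function.iterate_succ_apply', tent]; ring_nf
    refine ⟨L₃, ((h₁.trans h₂).trans h₃).mono (by omega), ht.mono subset_rfl le_rfl (by omega), ?_⟩
    refine (((hs₁.mono (h₂.trans h₃).subset (Nat.le_succ _) le_rfl).add_comb
      (ht.const_mul (1 / 4 ^ (m + 1)))).mono subset_rfl le_rfl (by omega)).congr fun x => ?_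
    rw [tentSum, tentSum, Finset.sum_range_succ]
    ring

theorem exists_mulApprox (M : ℝ) (m : ℕ) (hf : AffComb L ℓ 2 f) (hg : AffComb L ℓ 2 g)
    (hD : ℓ + (m + 1) ≤ D) :
    ∃ L', Extends D L L' (28 * m + 22) ∧
      AffComb L' (ℓ + (m + 1)) 2 (fun x => mulApprox M m (f x) (g x)) := by
  have ha : AffComb L ℓ 4 (fun x => (f x + g x) / (4 * M) + 1 / 2) :=
    (((hf.add_comb hg).const_mul (1 / (4 * M))).add_const (1 / 2)).congr fun x => by ring
  have hb : AffComb L ℓ 4 (fun x => (f x - g x) / (4 * M) + 1 / 2) :=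
    (((hf.add_comb (hg.const_mul (-1))).const_mul (1 / (4 * M))).add_const (1 / 2)).congr
      fun x => by ring
  obtain ⟨L₁, h₁, -, hs₁⟩ := exists_tentSum m ha (D := D) (by omega)
  obtain ⟨L₂, h₂, -, hs₂⟩ := exists_tentSum m (hb.mono h₁.subset le_rfl le_rfl) (D := D) (by omega)
  have hall : AffComb L₂ (ℓ + m) (4 * m + 10) (fun x => mulApprox M m (f x) (g x)) := by
    have h1 := (ha.mono (h₁.trans h₂).subset (Nat.le_add_right ℓ m) le_rfl).add_comb
      ((hs₁.mono h₂.subset le_rfl le_rfl).const_mul (-1))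
    have h2 := (hb.mono (h₁.trans h₂).subset (Nat.le_add_right ℓ m) le_rfl).add_comb
      (hs₂.const_mul (-1))
    have h3 := (((h1.add_comb (h2.const_mul (-1))).const_mul (4 * M ^ 2)).add_comb
      ((hg.mono (h₁.trans h₂).subset (Nat.le_add_right ℓ m) le_rfl).const_mul (-(2 * M))))
    refine (h3.mono subset_rfl le_rfl (by omega)).congr fun x => ?_
    rw [mulApprox]
    ring
  obtain ⟨L₃, h₃, hf₃⟩ := hall.exists_store (D := D) (by omega)
  exact ⟨L₃, ((h₁.trans h₂).trans h₃).mono (by omega), hf₃⟩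

/-- A product of boundedly many bounded factors is computed up to `O(4^{-m})` at cost `O(m)`. -/
theorem exists_prod (d : ℕ) {M : ℝ} (hM : 1 ≤ M) (r : ℕ) :
    ∃ c : ℝ, 0 ≤ c ∧ ∀ (X : Set (Fin d → ℝ)) (D ℓ m : ℕ) (L : Set (((Fin d → ℝ) → ℝ) × ℕ))
      (f : (Fin d → ℝ) → ℝ) (gs : List ((Fin d → ℝ) → ℝ)), gs.length ≤ r → AffComb L ℓ 2 f →
      (∀ g ∈ gs, AffComb L ℓ 2 g) → (∀ x ∈ X, |f x| ≤ M) → (∀ g ∈ gs, ∀ x ∈ X, |g x| ≤ M) →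
      ℓ + r * (m + 1) ≤ D →
      ∃ L' h, Extends D L L' (r * (28 * m + 22)) ∧ AffComb L' (ℓ + r * (m + 1)) 2 h ∧
        ∀ x ∈ X, |h x - f x * (gs.map fun g => g x).prod| ≤ c * (1 / 4) ^ m := by
  induction r with
  | zero =>
    refine ⟨0, le_rfl, fun X D ℓ m L f gs hgs hf _ _ _ _ => ?_⟩
    obtain rfl := List.length_eq_zero_iff.1 (Nat.le_zero.1 hgs)
    exact ⟨L, f, by simpa using Extends.refl, by simpa using hf, by simp⟩
  | succ r ih =>
    obtain ⟨c, hc, ih⟩ := ih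
    set M' : ℝ := M ^ (r + 1) + c
    have hMM' : M ≤ M' := (le_self_pow₀ hM (Nat.succ_ne_zero r)).trans (le_add_of_nonneg_right hc)
    refine ⟨2 * M' ^ 2 + c * M, by positivity, fun X D ℓ m L f gs hgs hf hg hfM hgM hD => ?_⟩
    rw [Nat.succ_mul] at hD
    rcases gs with _ | ⟨g, gs⟩
    · refine ⟨L, f, Extends.refl.mono (Nat.zero_le _), hf.mono subset_rfl (Nat.le_add_right _ _)
        le_rfl, fun x _ => ?_⟩
      simp only [List.map_nil, List.prod_nil, mul_one, sub_self, abs_zero]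
      positivity
    · simp only [List.length_cons, Nat.add_le_add_iff_right] at hgs
      obtain ⟨L₁, h, h₁, hh, herr⟩ := ih X D ℓ m L f gs hgs hf
        (fun g' hg' => hg g' (List.mem_cons_of_mem _ hg')) hfM
        (fun g' hg' => hgM g' (List.mem_cons_of_mem _ hg')) (by omega)
      obtain ⟨L₂, h₂, hp⟩ := exists_mulApprox M' m hh
        ((hg g List.mem_cons_self).mono h₁.subset (Nat.le_add_right _ _) le_rfl) (D := D) (by omega)
      refine ⟨L₂, _, (h₁.trans h₂).mono (Nat.succ_mul _ _).ge,
        hp.mono subset_rfl (by rw [Nat.succ_mul]; omega) le_rfl, fun x hx => ?_⟩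
      have hgx := hgM g List.mem_cons_self x hx
      have hprod : |f x * (gs.map fun g => g x).prod| ≤ M ^ (r + 1) := by
        have hl : |(gs.map fun g => g x).prod| ≤ M ^ r := by
          have hgs' : ∀ g' ∈ gs, |g' x| ≤ M := fun g' hg' =>
            hgM g' (List.mem_cons_of_mem _ hg') x hx
          clear herr hg hgM
          refine le_trans ?_ (pow_le_pow_right₀ hM hgs)
          induction gs with
          | nil => simp
          | cons g' gs ih' =>
            rw [List.map_cons, List.prod_cons, abs_mul, List.length_cons, pow_succ']
            have hlen : gs.length ≤ r := by
              rw [List.length_cons] at hgs; omega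
            exact mul_le_mul (hgs' g' List.mem_cons_self)
              (ih' hlen fun g'' hg'' => hgs' g'' (List.mem_cons_of_mem _ hg''))
              (abs_nonneg _) (by linarith)
        rw [abs_mul, pow_succ']
        exact mul_le_mul (hfM x hx) hl (abs_nonneg _) (by linarith)
      have hq : (1 / 4 : ℝ) ^ m ≤ 1 := pow_le_one₀ (by norm_num) (by norm_num)
      have herrx := herr x hx
      have hhx : |h x| ≤ M' := by
        have h3 : |h x| ≤ |f x * (gs.map fun g => g x).prod| +
            |h x - f x * (gs.map fun g => g x).prod| := by
          simpa using abs_add_le (f x * (gs.map fun g => g x).prod)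
            (h x - f x * (gs.map fun g => g x).prod)
        have h4 : c * (1 / 4) ^ m ≤ c := mul_le_of_le_one_right hc hq
        linarith
      have hmul := abs_mulApprox_sub_le (by linarith : 0 < M') m hhx (hgx.trans hMM')
      rw [List.map_cons, List.prod_cons]
      have hsplit : mulApprox M' m (h x) (g x) - f x * (g x * (gs.map fun g => g x).prod) =
          (mulApprox M' m (h x) (g x) - h x * g x) +
            (h x - f x * (gs.map fun g => g x).prod) * g x := by ring
      rw [hsplit]
      refine (abs_add_le _ _).trans ?_
      rw [abs_mul, add_mul]
      refine add_le_add hmul ?_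
      calc _ ≤ c * (1 / 4) ^ m * M := mul_le_mul herrx hgx (abs_nonneg _) (by positivity)
        _ = _ := by ring

end circuits

/-! ### Gluing local polynomials, interpolation and truncation -/

/-- Local polynomials `∑_j a_{c,j} ∏_{i ∈ l_j} (x_i - p_i)`, glued by the nodal functions of the
cells `c`, are computed up to `O(4^{-m})` at cost `O(#cells + m)`: the glued coefficients are
piecewise linear, so multiplications are needed for each `j` only and not for each cell. -/
theorem exists_glued_circuit (d : ℕ) {J : Type} [Fintype J] (l : J → List (Fin d)) {r : ℕ}
    (hl : ∀ j, (l j).length ≤ r) {M : ℝ} (hM : 1 ≤ M) :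
    ∃ c : ℝ, 0 ≤ c ∧ ∀ (X : Set (Fin d → ℝ)) (C : Finset (Fin d → ℤ))
      (a : (Fin d → ℤ) → J → ℝ) (p : Fin d → ℝ) (z : Fin d → (Fin d → ℝ) → ℝ) (D ℓ m : ℕ)
      (L : Set (((Fin d → ℝ) → ℝ) × ℕ)), (∀ c ∈ C, ∀ j, |a c j| ≤ M) →
      (∀ x ∈ X, ∀ i, |x i - p i| ≤ M) → (∀ x ∈ X, ∑ c ∈ C, hat (fun i => z i x - c i) = 1) →
      inputs d ⊆ L → (∀ i, AffComb L ℓ 2 (z i)) → ℓ + d + 2 + r * (m + 1) ≤ D →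
      ∃ L' F, Extends D L L' (C.card * (2 * (d * (2 + d + 1)) + (2 * d + 1)) +
          Fintype.card J * (2 * (C.card + 1) + r * (28 * m + 22))) ∧
        AffComb L' (ℓ + d + 2 + r * (m + 1)) (Fintype.card J * 2) F ∧
        ∀ x ∈ X, |F x - ∑ c ∈ C, hat (fun i => z i x - c i) *
          ∑ j, a c j * ((l j).map fun i => x i - p i).prod| ≤ c * (1 / 4) ^ m := by
  obtain ⟨c, hc, hprod⟩ := exists_prod d hM r
  refine ⟨Fintype.card J * c, by positivity, fun X C a p z D ℓ m L ha hX hPU hL hz hD => ?_⟩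
  -- the nodal functions
  obtain ⟨L₁, h₁, hhat⟩ := exists_extends_forall (D := D) (L := L)
    (n := 2 * (d * (2 + d + 1)) + (2 * d + 1)) C
    (Q := fun c L' => AffComb L' (ℓ + d + 1) 1 (fun x => hat (fun i => z i x - c i)))
    (fun _ _ _ hLL h => h.mono hLL le_rfl le_rfl) (fun c _ L' hL' =>
      exists_hat (fun i => (((hz i).add_const (-(c i : ℝ))).mono hL' le_rfl le_rfl).congr
        fun x => (sub_eq_add_neg _ _).symm) (by omega))
  -- the glued coefficients times the monomials
  let P : J → (Fin d → ℝ) → ℝ := fun j x => ∑ c ∈ C, a c j * hat (fun i => z i x - c i)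
  have hP : ∀ j, AffComb L₁ (ℓ + d + 1) C.card (P j) := fun j => by
    simpa using AffComb.sum C hhat (fun c => a c j)
  have hPM : ∀ j, ∀ x ∈ X, |P j x| ≤ M := fun j x hx => by
    calc |P j x| ≤ ∑ c ∈ C, |a c j * hat (fun i => z i x - c i)| := Finset.abs_sum_le_sum_abs _ _
      _ ≤ ∑ c ∈ C, M * hat (fun i => z i x - c i) := by
          refine Finset.sum_le_sum fun c hc => ?_
          rw [abs_mul, abs_of_nonneg (hat_nonneg _)]
          exact mul_le_mul_of_nonneg_right (ha c hc j) (hat_nonneg _)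
      _ = M := by rw [← Finset.mul_sum, hPU x hx, mul_one]
  obtain ⟨L₂, h₂, hq⟩ := exists_extends_forall (D := D) (L := L₁)
    (n := 2 * (C.card + 1) + r * (28 * m + 22)) (Finset.univ : Finset J)
    (Q := fun j L' => ∃ h, AffComb L' (ℓ + d + 2 + r * (m + 1)) 2 h ∧
      ∀ x ∈ X, |h x - P j x * ((l j).map fun i => x i - p i).prod| ≤ c * (1 / 4) ^ m)
    (fun _ _ _ hLL ⟨h, h1, h2⟩ => ⟨h, h1.mono hLL le_rfl le_rfl, h2⟩) (fun j _ L' hL' => by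
      obtain ⟨L₃, h₃, hs⟩ := ((hP j).mono hL' le_rfl le_rfl).exists_store (D := D) (by omega)
      obtain ⟨L₄, h, h₄, hh, herr⟩ := hprod X D (ℓ + d + 2) m L₃ (P j)
        ((l j).map fun i => fun x => x i - p i) (by simpa using hl j) hs (by
          intro g hg
          obtain ⟨i, -, rfl⟩ := List.mem_map.1 hg
          have hi : ((fun x : Fin d → ℝ => x i), 0) ∈ L₃ :=
            h₃.subset (hL' (h₁.subset (hL ⟨i, rfl⟩)))
          exact (((AffComb.of_mem hi (Nat.zero_le _)).add_const (-p i)).mono subset_rfl le_rfl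
            (by omega)).congr fun x => (sub_eq_add_neg _ _).symm) (hPM j) (by
          intro g hg x hx
          obtain ⟨i, -, rfl⟩ := List.mem_map.1 hg
          exact hX x hx i) (by omega)
      refine ⟨L₄, h₃.trans h₄, h, hh, fun x hx => ?_⟩
      have := herr x hx
      rwa [List.map_map] at this)
  choose! h hh herr using fun j => hq j (Finset.mem_univ j)
  refine ⟨L₂, fun x => ∑ j, h j x, h₁.trans (by simpa using h₂), ?_, fun x hx => ?_⟩
  · simpa using AffComb.sum Finset.univ (fun j _ => hh j) (fun _ => 1)
  · have hswap : ∑ c ∈ C, hat (fun i => z i x - c i) *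
        ∑ j, a c j * ((l j).map fun i => x i - p i).prod =
        ∑ j, P j x * ((l j).map fun i => x i - p i).prod := by
      simp_rw [P, Finset.mul_sum, Finset.sum_mul]
      rw [Finset.sum_comm]
      refine Finset.sum_congr rfl fun j _ => Finset.sum_congr rfl fun c _ => by ring
    rw [hswap, ← Finset.sum_sub_distrib]
    calc _ ≤ ∑ j, |h j x - P j x * ((l j).map fun i => x i - p i).prod| :=
          Finset.abs_sum_le_sum_abs _ _
      _ ≤ ∑ _j : J, c * (1 / 4) ^ m := Finset.sum_le_sum fun j _ => herr j x hx
      _ = _ := by simp [mul_assoc]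

/-- Gluing local approximations by a partition of unity. -/
theorem abs_sum_hat_mul_sub_le {d : ℕ} {C : Finset (Fin d → ℤ)} {y : Fin d → ℝ}
    (hPU : ∑ c ∈ C, hat (fun i => y i - c i) = 1) {u : (Fin d → ℤ) → ℝ} {b δ : ℝ}
    (hu : ∀ c ∈ C, hat (fun i => y i - c i) ≠ 0 → |u c - b| ≤ δ) :
    |∑ c ∈ C, hat (fun i => y i - c i) * u c - b| ≤ δ := by
  have h1 : ∑ c ∈ C, hat (fun i => y i - c i) * u c - b =
      ∑ c ∈ C, hat (fun i => y i - c i) * (u c - b) := by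
    simp_rw [mul_sub]
    rw [Finset.sum_sub_distrib, ← Finset.sum_mul, hPU, one_mul]
  rw [h1]
  calc _ ≤ ∑ c ∈ C, |hat (fun i => y i - c i) * (u c - b)| := Finset.abs_sum_le_sum_abs _ _
    _ ≤ ∑ c ∈ C, hat (fun i => y i - c i) * δ := by
        refine Finset.sum_le_sum fun c hc => ?_
        rw [abs_mul, abs_of_nonneg (hat_nonneg _)]
        by_cases h : hat (fun i => y i - c i) = 0
        · simp [h]
        · exact mul_le_mul_of_nonneg_left (hu c hc h) (hat_nonneg _)
    _ = δ := by rw [← Finset.sum_mul, hPU, one_mul]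

/-- Truncation to the interval `[A₀, A₁]`, written with two ReLU terms. -/
def clamp (A₀ A₁ y : ℝ) : ℝ := A₀ + max 0 (y - A₀) - max 0 (y - A₁)

theorem clamp_mem_Icc {A₀ A₁ : ℝ} (hA : A₀ ≤ A₁) (y : ℝ) : clamp A₀ A₁ y ∈ Icc A₀ A₁ := by
  rw [clamp]
  rcases le_total y A₀ with h | h
  · rw [max_eq_left (by linarith), max_eq_left (by linarith)]
    constructor <;> linarith
  · rw [max_eq_right (by linarith)]
    rcases le_total y A₁ with h' | h'
    · rw [max_eq_left (by linarith)]; constructor <;> linarith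
    · rw [max_eq_right (by linarith)]; constructor <;> linarith

theorem clamp_eq_self {A₀ A₁ y : ℝ} (hy : y ∈ Icc A₀ A₁) : clamp A₀ A₁ y = y := by
  rw [clamp, max_eq_right (by linarith [hy.1]), max_eq_left (by linarith [hy.2])]
  ring

theorem abs_clamp_sub_le {A₀ A₁ : ℝ} (y : ℝ) {b : ℝ} (hb : b ∈ Icc A₀ A₁) :
    |clamp A₀ A₁ y - b| ≤ |y - b| := by
  rw [clamp]
  obtain ⟨h1, h2⟩ := hb
  rcases le_total y A₀ with h | h
  · rw [max_eq_left (by linarith), max_eq_left (by linarith), abs_sub_comm, abs_sub_comm y,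
      abs_of_nonneg (by linarith), abs_of_nonneg (by linarith)]
    linarith
  · rw [max_eq_right (by linarith)]
    rcases le_total y A₁ with h' | h'
    · rw [max_eq_left (by linarith)]
      exact (congrArg abs (by ring)).le
    · rw [max_eq_right (by linarith), abs_of_nonneg (by linarith), abs_of_nonneg (by linarith)]
      linarith

/-- The spike of height one at `g` that vanishes at distance `δ` from `g`. -/
def spike {d : ℕ} (δ : ℝ) (g x : Fin d → ℝ) : ℝ := hat (fun i => δ⁻¹ * (x i - g i))

theorem spike_self {d : ℕ} (δ : ℝ) (g : Fin d → ℝ) : spike δ g g = 1 := by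
  simpa [spike] using! (hat_zero (d := d))

theorem norm_sub_lt_of_spike_ne_zero {d : ℕ} {δ : ℝ} (hδ : 0 < δ) {g x : Fin d → ℝ}
    (h : spike δ g x ≠ 0) : ‖x - g‖ < δ := by
  rw [pi_norm_lt_iff hδ]
  intro i
  have := abs_lt_one_of_hat_ne_zero h i
  rwa [abs_mul, abs_of_pos (inv_pos.2 hδ), inv_mul_lt_iff₀ hδ, mul_one] at this

/-- An approximation `F` of `β` is corrected to an approximation that takes prescribed values `v`
at the points of a finite set `G`: spikes of disjoint supports are added, which are small at
points of `X` and otherwise supported off `X`. -/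
theorem abs_add_spikes_sub_le {d : ℕ} {X : Set (Fin d → ℝ)} {G : Finset (Fin d → ℝ)}
    {F β v : (Fin d → ℝ) → ℝ} {δ η : ℝ} (hδ : 0 < δ) (hF : ∀ x ∈ X, |F x - β x| ≤ η)
    (hG : ∀ g ∈ G, ∀ g' ∈ G, g' ≠ g → 2 * δ ≤ ‖g' - g‖)
    (hGX : ∀ g ∈ G, (g ∈ X ∧ v g = β g) ∨ ∀ x ∈ X, δ ≤ ‖x - g‖) {x : Fin d → ℝ} (hx : x ∈ X) :
    |F x + ∑ g ∈ G, (v g - F g) * spike δ g x - β x| ≤ 2 * η := by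
  have hη : 0 ≤ η := (abs_nonneg _).trans (hF x hx)
  have hsum : |∑ g ∈ G, (v g - F g) * spike δ g x| ≤ η := by
    by_cases h : ∃ g ∈ G, spike δ g x ≠ 0
    · obtain ⟨g, hg, hgx⟩ := h
      have hlt := norm_sub_lt_of_spike_ne_zero hδ hgx
      rw [Finset.sum_eq_single_of_mem g hg]
      · rcases hGX g hg with ⟨hgX, hv⟩ | hfar
        · have h0 : 0 ≤ spike δ g x := hat_nonneg _
          rw [abs_mul, abs_of_nonneg h0, hv, abs_sub_comm]
          exact (mul_le_mul_of_nonneg_right (hF g hgX) h0).trans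
            (mul_le_of_le_one_right hη (hat_le_one _))
        · exact absurd hlt (hfar x hx).not_gt
      · intro g' hg' hne
        by_cases h0 : spike δ g' x = 0
        · rw [h0, mul_zero]
        · have hlt' := norm_sub_lt_of_spike_ne_zero hδ h0
          have h1 := hG g hg g' hg' hne
          have h2 := norm_sub_le (x - g) (x - g')
          rw [sub_sub_sub_cancel_left] at h2
          linarith
    · push Not at h
      rw [Finset.sum_eq_zero fun g hg => by rw [h g hg, mul_zero]]
      simpa using hη
  have h1 : F x + ∑ g ∈ G, (v g - F g) * spike δ g x - β x =
      (F x - β x) + ∑ g ∈ G, (v g - F g) * spike δ g x := by ring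
  rw [h1]
  exact (abs_add_le _ _).trans (by linarith [hF x hx])

theorem add_spikes_apply {d : ℕ} {G : Finset (Fin d → ℝ)} {F v : (Fin d → ℝ) → ℝ} {δ : ℝ}
    (hδ : 0 < δ) (hG : ∀ g ∈ G, ∀ g' ∈ G, g' ≠ g → 2 * δ ≤ ‖g' - g‖) {g : Fin d → ℝ}
    (hg : g ∈ G) : F g + ∑ g' ∈ G, (v g' - F g') * spike δ g' g = v g := by
  rw [Finset.sum_eq_single_of_mem g hg, spike_self]
  · ring
  · intro g' hg' hne
    by_cases h0 : spike δ g' g = 0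
    · rw [h0, mul_zero]
    · have h1 := norm_sub_lt_of_spike_ne_zero hδ h0
      have h2 := hG g' hg' g hg hne.symm
      linarith

theorem exists_spikes_clamp {d D ℓ t : ℕ} {L : Set (((Fin d → ℝ) → ℝ) × ℕ)} (hL : inputs d ⊆ L)
    {F : (Fin d → ℝ) → ℝ} (hF : AffComb L ℓ t F) (G : Finset (Fin d → ℝ)) (w : (Fin d → ℝ) → ℝ)
    (δ A₀ A₁ : ℝ) (hℓ : d + 1 ≤ ℓ) (hD : ℓ + 1 ≤ D) :
    ∃ L', Extends D L L' (G.card * (2 * (d * (1 + d + 1)) + (2 * d + 1)) +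
        2 * (t + G.card + 1)) ∧
      AffComb L' D 2 (fun x => clamp A₀ A₁ (F x + ∑ g ∈ G, w g * spike δ g x)) := by
  obtain ⟨L₁, h₁, hs⟩ := exists_extends_forall (D := D) (L := L)
    (n := 2 * (d * (1 + d + 1)) + (2 * d + 1)) G
    (Q := fun g L' => AffComb L' (0 + d + 1) 1 (spike δ g))
    (fun _ _ _ hLL h => h.mono hLL le_rfl le_rfl) (fun g _ L' hL' =>
      exists_hat (fun i => (((AffComb.of_mem (hL' (hL ⟨i, rfl⟩)) le_rfl).add_const
        (-g i)).const_mul δ⁻¹).congr fun x => by rw [sub_eq_add_neg]) (by omega))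
  have hsum : AffComb L₁ ℓ (t + G.card) (fun x => F x + ∑ g ∈ G, w g * spike δ g x) := by
    have := AffComb.sum G (fun g hg => (hs g hg).mono subset_rfl (by omega : 0 + d + 1 ≤ ℓ) le_rfl) w
    rw [mul_one] at this
    exact (hF.mono h₁.subset le_rfl le_rfl).add_comb this
  obtain ⟨L₂, h₂, hf₂⟩ := (hsum.add_const (-A₀)).exists_relu hD
  obtain ⟨L₃, h₃, hf₃⟩ := ((hsum.add_const (-A₁)).mono h₂.subset le_rfl le_rfl).exists_relu hD
  refine ⟨L₃, ((h₁.trans h₂).trans h₃).mono (by omega), ?_⟩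
  refine (((((hf₂.mono h₃.subset le_rfl le_rfl).add_comb (hf₃.const_mul (-1))).add_const
    A₀)).mono subset_rfl hD le_rfl).congr fun x => ?_
  rw [clamp]
  simp only [sub_eq_add_neg]
  ring

/-- Networks for glued local polynomials: approximation on `X`, interpolation on `G`, values in
`[A₀, A₁]`. The feature map `z`, of cost `n₀`, selects the cells. -/
theorem exists_network_of_local (d : ℕ) {J : Type} [Fintype J] (l : J → List (Fin d)) {M : ℝ}
    (hM : 1 ≤ M) :
    ∃ c : ℝ, 0 < c ∧ ∀ (X : Set (Fin d → ℝ)) (C : Finset (Fin d → ℤ))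
      (a : (Fin d → ℤ) → J → ℝ) (p : Fin d → ℝ) (z : Fin d → (Fin d → ℝ) → ℝ) (m n₀ : ℕ)
      (L : Set (((Fin d → ℝ) → ℝ) × ℕ)) (β v : (Fin d → ℝ) → ℝ) (G : Finset (Fin d → ℝ))
      (A₀ A₁ δ η : ℝ), (∀ c ∈ C, ∀ j, |a c j| ≤ M) →
      (∀ x ∈ X, ∀ i, |x i - p i| ≤ M) → (∀ x ∈ X, ∑ c ∈ C, hat (fun i => z i x - c i) = 1) →
      (∀ x ∈ X, ∀ c ∈ C, hat (fun i => z i x - c i) ≠ 0 →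
        |∑ j, a c j * ((l j).map fun i => x i - p i).prod - β x| ≤ η) →
      (∀ D, 2 ≤ D → Extends D (inputs d) L n₀) → (∀ i, AffComb L 2 2 (z i)) →
      A₀ ≤ A₁ → (∀ x ∈ X, β x ∈ Icc A₀ A₁) → (∀ g ∈ G, v g ∈ Icc A₀ A₁) → 0 < δ →
      (∀ g ∈ G, ∀ g' ∈ G, g' ≠ g → 2 * δ ≤ ‖g' - g‖) →
      (∀ g ∈ G, (g ∈ X ∧ v g = β g) ∨ ∀ x ∈ X, δ ≤ ‖x - g‖) →
      ∃ F : ReLUNetwork d, (F.depth : ℝ) ≤ c * (m + 1) ∧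
        (F.size : ℝ) ≤ c * (C.card + G.card + m + n₀ + 1) ∧
        (∀ x, F.eval x ∈ Icc A₀ A₁) ∧ (∀ g ∈ G, F.eval g = v g) ∧
        ∀ x ∈ X, |F.eval x - β x| ≤ 2 * (η + c * (1 / 4) ^ m) := by
  obtain ⟨r, hr⟩ : ∃ r, ∀ j, (l j).length ≤ r :=
    ⟨Finset.univ.sup fun j => (l j).length, fun j =>
      Finset.le_sup (f := fun j => (l j).length) (Finset.mem_univ j)⟩
  obtain ⟨c₀, hc₀, hglue⟩ := exists_glued_circuit d l hr hM
  let q := Fintype.card J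
  let K₁ : ℕ := 2 * (d * (2 + d + 1)) + (2 * d + 1)
  let K₂ : ℕ := 2 * (d * (1 + d + 1)) + (2 * d + 1)
  let K : ℕ := 1 + K₁ + q * (4 + 50 * r) + K₂ + (4 * q + 4) + 3 + (d + 7 + r)
  refine ⟨c₀ + K, by positivity, ?_⟩
  intro X C a p z m n₀ L β v G A₀ A₁ δ η ha hX hPU hloc hL hz hA hβ hv hδ hG hGX
  let ℓ : ℕ := 2 + d + 2 + r * (m + 1)
  let D : ℕ := ℓ + 1
  have hL' := hL D (by omega)
  obtain ⟨L₁, F₀, h₁, hF₀, herr⟩ := hglue X C a p z D 2 m L ha hX hPU hL'.subset hz (by omega)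
  have hF₀β : ∀ x ∈ X, |F₀ x - β x| ≤ η + c₀ * (1 / 4) ^ m := fun x hx => by
    have h1 := herr x hx
    have h2 := abs_sum_hat_mul_sub_le (hPU x hx) (hloc x hx)
    have h3 := abs_sub_le (F₀ x) (∑ c ∈ C, hat (fun i => z i x - c i) *
      ∑ j, a c j * ((l j).map fun i => x i - p i).prod) (β x)
    linarith
  obtain ⟨L₂, h₂, hF⟩ := exists_spikes_clamp (D := D) (hL'.subset.trans h₁.subset) hF₀ G
    (fun g => v g - F₀ g) δ A₀ A₁ (by omega) (by omega)
  obtain ⟨F, hdepth, hsize, heval⟩ := ((hL'.trans h₁).trans h₂).exists_eval_eq hF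
  refine ⟨F, ?_, ?_, fun x => ?_, fun g hg => ?_, fun x hx => ?_⟩
  · have h1 : F.depth ≤ K * (m + 1) := by
      refine hdepth.trans ?_
      have : (2 + d + 2 + r * (m + 1)) + 1 + 2 ≤ (d + 7 + r) * (m + 1) := by
        have := Nat.le_mul_of_pos_right (d + 7) (by omega : 0 < m + 1)
        rw [Nat.add_mul]
        omega
      exact this.trans (Nat.mul_le_mul_right _ (Nat.le_add_left _ _))
    calc (F.depth : ℝ) ≤ K * (m + 1) := by exact_mod_cast h1
      _ ≤ _ := by gcongr; linarith
  · have h1 : F.size ≤ K * (C.card + G.card + m + n₀ + 1) := by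
      refine hsize.trans ?_
      set s := C.card + G.card + m + n₀ + 1 with hs
      have e1 : C.card ≤ s := by omega
      have e2 : G.card ≤ s := by omega
      have e3 : m ≤ s := by omega
      have e4 : n₀ ≤ s := by omega
      have e5 : 1 ≤ s := by omega
      calc n₀ + (C.card * K₁ + q * (2 * (C.card + 1) + r * (28 * m + 22))) +
            (G.card * K₂ + 2 * (q * 2 + G.card + 1)) + 2 + 1
          ≤ s + (s * K₁ + q * (2 * (s + s) + r * (28 * s + 22 * s))) +
            (s * K₂ + 2 * (q * 2 * s + s + s)) + 2 * s + 1 * s := by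
            refine Nat.add_le_add (Nat.add_le_add (Nat.add_le_add (Nat.add_le_add e4
              (Nat.add_le_add ?_ ?_)) (Nat.add_le_add ?_ ?_)) ?_) ?_
            · gcongr
            · gcongr; omega
            · gcongr
            · exact Nat.mul_le_mul_left _ (Nat.add_le_add (Nat.add_le_add
                (Nat.le_mul_of_pos_right _ e5) e2) e5)
            · omega
            · omega
        _ = (1 + K₁ + q * (4 + 50 * r) + K₂ + (4 * q + 4) + 3) * s := by ring
        _ ≤ K * s := Nat.mul_le_mul_right _ (Nat.le_add_right _ _)
    calc (F.size : ℝ) ≤ K * (C.card + G.card + m + n₀ + 1) := by exact_mod_cast h1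
      _ ≤ _ := by gcongr; linarith
  · rw [heval]
    exact clamp_mem_Icc hA _
  · rw [heval, add_spikes_apply hδ hG hg]
    exact clamp_eq_self (hv g hg)
  · rw [heval]
    refine (abs_clamp_sub_le _ (hβ x hx)).trans ?_
    refine (abs_add_spikes_sub_le hδ hF₀β hG hGX hx).trans ?_
    gcongr
    exact le_add_of_nonneg_right K.cast_nonneg

/-! ### Networks from jets -/

/-- Index set of the monomials that arise when the products `∏_j (v_{i_j} + w_{i_j})` in a jet
polynomial of degree less than `k` are multiplied out: the factors `v` are chosen on a subset. -/
abbrev MonomialIndex (d k : ℕ) : Type := Σ n : Fin k, (Fin n → Fin d) × Finset (Fin n)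

/-- The coordinates that occur in a monomial, with repetition. -/
def monomialVars {d k : ℕ} (j : MonomialIndex d k) : List (Fin d) :=
  j.2.2.toList.map j.2.1

/-- The coefficients of a jet polynomial after the translation by `w`. -/
def recenterCoeff {d k : ℕ} (a : (n : ℕ) → (Fin n → Fin d) → ℝ) (w : Fin d → ℝ)
    (j : MonomialIndex d k) : ℝ :=
  ((j.1 : ℕ).factorial : ℝ)⁻¹ * (a j.1 j.2.1 * ∏ b ∈ Finset.univ \ j.2.2, w (j.2.1 b))

theorem jetPoly_add {d k : ℕ} (a : (n : ℕ) → (Fin n → Fin d) → ℝ) (v w : Fin d → ℝ) :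
    jetPoly k a (v + w) =
      ∑ j : MonomialIndex d k, recenterCoeff a w j * ((monomialVars j).map v).prod := by
  rw [jetPoly, Finset.sum_range, Fintype.sum_sigma]
  refine Finset.sum_congr rfl fun n _ => ?_
  rw [Fintype.sum_prod_type, Finset.mul_sum]
  refine Finset.sum_congr rfl fun i _ => ?_
  simp only [Pi.add_apply]
  rw [Finset.prod_add, Finset.powerset_univ, Finset.mul_sum, Finset.mul_sum]
  refine Finset.sum_congr rfl fun T _ => ?_
  have h : ((monomialVars (⟨n, i, T⟩ : MonomialIndex d k)).map v).prod = ∏ b ∈ T, v (i b) := by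
    rw [monomialVars, List.map_map, Finset.prod_map_toList]
    rfl
  rw [h, recenterCoeff]
  ring

theorem abs_recenterCoeff_le {d k : ℕ} {a : (n : ℕ) → (Fin n → Fin d) → ℝ}
    (ha : ∀ n i, |a n i| ≤ 1) {w : Fin d → ℝ} {M : ℝ} (hM : 1 ≤ M) (hw : ∀ i, |w i| ≤ M)
    (j : MonomialIndex d k) : |recenterCoeff a w j| ≤ M ^ k := by
  obtain ⟨n, i, T⟩ := j
  have h1 : |((n : ℕ).factorial : ℝ)⁻¹| ≤ 1 := by
    rw [abs_of_nonneg (by positivity)]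
    exact inv_le_one_of_one_le₀ (by exact_mod_cast (n : ℕ).factorial_pos)
  have h2 : |∏ b ∈ Finset.univ \ T, w (i b)| ≤ M ^ k := by
    rw [Finset.abs_prod]
    calc _ ≤ ∏ _b ∈ Finset.univ \ T, M :=
          Finset.prod_le_prod (fun _ _ => abs_nonneg _) fun b _ => hw _
      _ = M ^ (Finset.univ \ T).card := Finset.prod_const _
      _ ≤ M ^ k := by
          refine pow_le_pow_right₀ hM ?_
          exact (Finset.card_le_univ _).trans (by simp)
  rw [recenterCoeff, abs_mul, abs_mul]
  calc _ ≤ 1 * (1 * M ^ k) := by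
        gcongr
        exact ha _ _
    _ = M ^ k := by ring

theorem card_piFinset_Icc_le {d : ℕ} {lo hi : ℝ} (h : lo ≤ hi) :
    ((Fintype.piFinset fun _ : Fin d => Finset.Icc ⌊lo⌋ (⌊hi⌋ + 1)).card : ℝ) ≤
      (hi - lo + 3) ^ d := by
  rw [Fintype.card_piFinset_const, Int.card_Icc, Nat.cast_pow]
  gcongr
  have h1 : ⌊lo⌋ ≤ ⌊hi⌋ := Int.floor_le_floor h
  have h2 : (((⌊hi⌋ + 1 + 1 - ⌊lo⌋).toNat : ℤ) : ℝ) = (⌊hi⌋ + 1 + 1 - ⌊lo⌋ : ℤ) := by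
    rw [Int.toNat_of_nonneg (by omega)]
  rw [Int.cast_natCast] at h2
  rw [h2]
  push_cast
  linarith [Int.floor_le hi, Int.lt_floor_add_one lo]

/-- Networks for a function with local jet polynomials. Cells are the unit cubes of the feature
map `z`; each nonempty cell needs a jet that is valid at all points of `X` in the cell. -/
theorem exists_network_of_jets (d k : ℕ) {ρ : ℝ} (hρ : 1 ≤ ρ) :
    ∃ c : ℝ, 0 < c ∧ ∀ (X : Set (Fin d → ℝ)) (p : Fin d → ℝ) (z : Fin d → (Fin d → ℝ) → ℝ)
      (lo hi : ℝ) (m n₀ : ℕ) (L : Set (((Fin d → ℝ) → ℝ) × ℕ)) (β v : (Fin d → ℝ) → ℝ)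
      (G : Finset (Fin d → ℝ)) (A₀ A₁ δ η : ℝ), (∀ x ∈ X, ∀ i, |x i - p i| ≤ ρ) → lo ≤ hi →
      (∀ x ∈ X, ∀ i, z i x ∈ Icc lo hi) →
      (∀ c : Fin d → ℤ, ∀ x₁ ∈ X, (∀ i, |z i x₁ - c i| < 1) → ∃ x₀ ∈ X,
        ∃ a : (n : ℕ) → (Fin n → Fin d) → ℝ, (∀ n i, |a n i| ≤ 1) ∧
          ∀ x ∈ X, (∀ i, |z i x - c i| < 1) → |β x - jetPoly k a (x - x₀)| ≤ η) →
      (∀ D, 2 ≤ D → Extends D (inputs d) L n₀) → (∀ i, AffComb L 2 2 (z i)) →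
      A₀ ≤ A₁ → (∀ x ∈ X, β x ∈ Icc A₀ A₁) → (∀ g ∈ G, v g ∈ Icc A₀ A₁) → 0 < δ →
      (∀ g ∈ G, ∀ g' ∈ G, g' ≠ g → 2 * δ ≤ ‖g' - g‖) →
      (∀ g ∈ G, (g ∈ X ∧ v g = β g) ∨ ∀ x ∈ X, δ ≤ ‖x - g‖) →
      ∃ F : ReLUNetwork d, (F.depth : ℝ) ≤ c * (m + 1) ∧
        (F.size : ℝ) ≤ c * ((hi - lo + 3) ^ d + G.card + m + n₀ + 1) ∧
        (∀ x, F.eval x ∈ Icc A₀ A₁) ∧ (∀ g ∈ G, F.eval g = v g) ∧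
        ∀ x ∈ X, |F.eval x - β x| ≤ 2 * (η + c * (1 / 4) ^ m) := by
  obtain ⟨c, hc, hnet⟩ := exists_network_of_local d (monomialVars (d := d) (k := k))
    (M := ρ ^ (k + 1)) (one_le_pow₀ hρ)
  refine ⟨c, hc, ?_⟩
  intro X p z lo hi m n₀ L β v G A₀ A₁ δ η hX hlo hz hjet hL hzL hA hβ hv hδ hG hGX
  have hρk : ρ ≤ ρ ^ (k + 1) := le_self_pow₀ hρ (Nat.succ_ne_zero k)
  have hcoef : ∀ c : Fin d → ℤ, ∃ b : MonomialIndex d k → ℝ, (∀ j, |b j| ≤ ρ ^ (k + 1)) ∧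
      ∀ x ∈ X, hat (fun i => z i x - c i) ≠ 0 →
        |∑ j, b j * ((monomialVars j).map fun i => x i - p i).prod - β x| ≤ η := by
    intro c
    by_cases h : ∃ x₁ ∈ X, ∀ i, |z i x₁ - c i| < 1
    · obtain ⟨x₁, hx₁, hc₁⟩ := h
      obtain ⟨x₀, hx₀, a, ha, hax⟩ := hjet c x₁ hx₁ hc₁
      refine ⟨recenterCoeff a (p - x₀), fun j => ?_, fun x hx hne => ?_⟩
      · refine (abs_recenterCoeff_le ha hρ (fun i => ?_) j).trans
          (pow_le_pow_right₀ hρ (Nat.le_succ k))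
        rw [Pi.sub_apply, abs_sub_comm]
        exact hX x₀ hx₀ i
      · have h1 := hax x hx (abs_lt_one_of_hat_ne_zero hne)
        rw [← sub_add_sub_cancel x p x₀, jetPoly_add, abs_sub_comm] at h1
        exact h1
    · refine ⟨0, fun j => by simpa using by positivity, fun x hx hne => ?_⟩
      exact absurd ⟨x, hx, abs_lt_one_of_hat_ne_zero hne⟩ h
  choose b hb hbx using hcoef
  obtain ⟨F, h1, h2, h3, h4, h5⟩ := hnet X
    (Fintype.piFinset fun _ => Finset.Icc ⌊lo⌋ (⌊hi⌋ + 1)) b p z m n₀ L β v G A₀ A₁ δ η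
    (fun c _ => hb c) (fun x hx i => (hX x hx i).trans hρk) (fun x hx => sum_hat_eq_one (by
      intro θ hθ
      rw [Fintype.mem_piFinset]
      intro i
      obtain ⟨hz1, hz2⟩ := hz x hx i
      rw [Finset.mem_Icc]
      refine ⟨Int.floor_le_floor (by linarith [hθ.1]), ?_⟩
      rw [← Int.floor_add_one]
      exact Int.floor_le_floor (by linarith [hθ.2])))
    (fun x hx c _ hne => hbx c x hx hne) hL hzL hA hβ hv hδ hG hGX
  refine ⟨F, h1, h2.trans ?_, h3, h4, h5⟩
  have := card_piFinset_Icc_le (d := d) hlo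
  gcongr

/-! ### Mesh size and the removable case -/

theorem half_le_log_inv {ε : ℝ} (hε : 0 < ε) (hε2 : ε ≤ 1 / 2) : 1 / 2 ≤ Real.log (1 / ε) := by
  have h1 : (2 : ℝ) ≤ 1 / ε := by rw [le_div_iff₀ hε]; linarith
  have h2 := Real.log_le_log (by norm_num) h1
  linarith [Real.log_two_gt_d9]

theorem exists_iterations {c : ℝ} (hc : 0 < c) :
    ∃ K : ℝ, 0 < K ∧ ∀ ε : ℝ, 0 < ε → ε ≤ 1 / 2 →
      ∃ m : ℕ, c * (1 / 4) ^ m ≤ ε / 4 ∧ (m + 1 : ℝ) ≤ K * Real.log (1 / ε) := by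
  refine ⟨2 * (|Real.log (4 * c)| + 2) + 1, by positivity, fun ε hε hε2 => ?_⟩
  have hl := half_le_log_inv hε hε2
  have hlog : Real.log (4 * c / ε) = Real.log (4 * c) + Real.log (1 / ε) := by
    rw [← Real.log_mul (by positivity) (by positivity), mul_one_div]
  refine ⟨⌈Real.log (4 * c / ε)⌉₊, ?_, ?_⟩
  · set m := ⌈Real.log (4 * c / ε)⌉₊
    have h1 : Real.log (4 * c / ε) ≤ m := Nat.le_ceil _
    have h2 : 4 * c / ε ≤ Real.exp 1 ^ m := by
      rw [← Real.exp_nat_mul, mul_one]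
      calc 4 * c / ε = Real.exp (Real.log (4 * c / ε)) := (Real.exp_log (by positivity)).symm
        _ ≤ _ := Real.exp_le_exp.2 h1
    have h3 : Real.exp 1 ^ m ≤ 4 ^ m :=
      pow_le_pow_left₀ (Real.exp_pos 1).le (by linarith [Real.exp_one_lt_d9]) m
    have h4 := h2.trans h3
    rw [div_le_iff₀ hε] at h4
    rw [one_div, inv_pow, ← div_eq_mul_inv, div_le_iff₀ (by positivity)]
    linarith
  · have h1 : (⌈Real.log (4 * c / ε)⌉₊ : ℝ) ≤ |Real.log (4 * c)| + Real.log (1 / ε) + 1 := by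
      rcases le_total 0 (Real.log (4 * c / ε)) with h | h
      · have := (Nat.ceil_lt_add_one h).le
        rw [hlog] at this ⊢
        linarith [le_abs_self (Real.log (4 * c))]
      · rw [Nat.ceil_eq_zero.2 h]
        have := abs_nonneg (Real.log (4 * c))
        push_cast
        linarith
    nlinarith [abs_nonneg (Real.log (4 * c))]

theorem exists_meshsize (d k : ℕ) (hd : 1 ≤ d) (hk : 1 ≤ k) :
    ∃ K : ℝ, 0 < K ∧ ∀ ε : ℝ, 0 < ε → ε ≤ 1 / 2 →
      ∃ h : ℝ, 0 < h ∧ h ≤ 1 ∧ (d : ℝ) ^ k * (2 * h) ^ k ≤ ε / 4 ∧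
        (1 / h) ^ d ≤ K * ε ^ (-(d : ℝ) / (k : ℝ)) := by
  have hd0 : (1 : ℝ) ≤ d := by exact_mod_cast hd
  have hk0 : (k : ℝ) ≠ 0 := by
    have : k ≠ 0 := by omega
    exact_mod_cast this
  refine ⟨(2 * d) ^ d * 4 ^ ((d : ℝ) / k), by positivity, fun ε hε hε2 => ?_⟩
  have hr : 0 < (ε / 4) ^ (1 / (k : ℝ)) := Real.rpow_pos_of_pos (by positivity) _
  have hrk : ((ε / 4) ^ (1 / (k : ℝ))) ^ k = ε / 4 := by
    rw [← Real.rpow_natCast, ← Real.rpow_mul (by positivity), one_div_mul_cancel hk0, Real.rpow_one]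
  refine ⟨(ε / 4) ^ (1 / (k : ℝ)) / (2 * d), by positivity, ?_, ?_, ?_⟩
  · rw [div_le_one (by positivity)]
    refine (Real.rpow_le_one (by positivity) (by linarith) (by positivity)).trans (by linarith)
  · rw [← mul_pow]
    have : (d : ℝ) * (2 * ((ε / 4) ^ (1 / (k : ℝ)) / (2 * d))) = (ε / 4) ^ (1 / (k : ℝ)) := by
      field_simp
    rw [this, hrk]
  · rw [one_div_div, div_pow, ← Real.rpow_natCast ((ε / 4) ^ (1 / (k : ℝ))),
      ← Real.rpow_mul (by positivity), Real.div_rpow hε.le (by norm_num), neg_div,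
      Real.rpow_neg hε.le, one_div_mul_eq_div, div_div_eq_mul_div]
    exact le_of_eq (div_eq_mul_inv _ _)

/-- The choice of the mesh size and of the number of iterations in the squaring network. The terms
`11 g` and `5 (m + 1)` leave room for the cells and units that the jump feature of the
one-dimensional case adds. -/
theorem exists_parameters (d k : ℕ) (hd : 1 ≤ d) (hk : 1 ≤ k) {ρ c : ℝ} (hρ : 1 ≤ ρ)
    (hc : 0 < c) :
    ∃ K : ℝ, 0 < K ∧ ∀ ε : ℝ, 0 < ε → ε ≤ 1 / 2 →
      ∃ (m : ℕ) (h : ℝ), 0 < h ∧ (d : ℝ) ^ k * (2 * h) ^ k ≤ ε / 4 ∧ c * (1 / 4) ^ m ≤ ε / 4 ∧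
        c * (m + 1) ≤ K * Real.log (1 / ε) ∧
        ∀ g : ℝ, 0 ≤ g → c * ((2 * ρ / h + 3) ^ d + 11 * g + 5 * (m + 1)) ≤
          K * (ε ^ (-(d : ℝ) / (k : ℝ)) * Real.log (1 / ε) + g) := by
  obtain ⟨K₁, hK₁, hm⟩ := exists_iterations hc
  obtain ⟨K₂, hK₂, hh⟩ := exists_meshsize d k hd hk
  refine ⟨c * (2 * (2 * ρ + 3) ^ d * K₂ + 5 * K₁ + 11), by positivity, fun ε hε hε2 => ?_⟩
  obtain ⟨m, hm1, hm2⟩ := hm ε hε hε2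
  obtain ⟨h, h0, h1, hh1, hh2⟩ := hh ε hε hε2
  have hl := half_le_log_inv hε hε2
  refine ⟨m, h, h0, hh1, hm1, ?_, fun g hg => ?_⟩
  · rw [mul_assoc]
    refine mul_le_mul_of_nonneg_left (hm2.trans ?_) hc.le
    refine mul_le_mul_of_nonneg_right ?_ (by linarith)
    have : 0 ≤ 2 * (2 * ρ + 3) ^ d * K₂ := by positivity
    linarith
  · set e := ε ^ (-(d : ℝ) / (k : ℝ))
    have he : 1 ≤ e := Real.one_le_rpow_of_pos_of_le_one_of_nonpos hε (by linarith) (by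
      rw [neg_div]
      exact neg_nonpos.2 (by positivity))
    set l := Real.log (1 / ε)
    have h2 : (2 * ρ / h + 3) ^ d ≤ 2 * (2 * ρ + 3) ^ d * K₂ * (e * l) := by
      have h3 : 2 * ρ / h + 3 ≤ (2 * ρ + 3) * (1 / h) := by
        have : 1 ≤ 1 / h := by rw [le_div_iff₀ h0]; linarith
        rw [add_mul, mul_one_div]
        linarith
      calc (2 * ρ / h + 3) ^ d ≤ ((2 * ρ + 3) * (1 / h)) ^ d :=
            pow_le_pow_left₀ (by positivity) h3 d
        _ = (2 * ρ + 3) ^ d * (1 / h) ^ d := mul_pow _ _ _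
        _ ≤ (2 * ρ + 3) ^ d * (K₂ * e) := by gcongr
        _ ≤ (2 * ρ + 3) ^ d * (K₂ * e) * (2 * l) :=
            le_mul_of_one_le_right (by positivity) (by linarith)
        _ = _ := by ring
    have h4 : (m + 1 : ℝ) ≤ K₁ * (e * l) := hm2.trans (by
      gcongr
      exact le_mul_of_one_le_left (by linarith) he)
    rw [mul_assoc]
    refine mul_le_mul_of_nonneg_left ?_ hc.le
    have h5 : 0 ≤ (2 * (2 * ρ + 3) ^ d * K₂ + 5 * K₁) * g := by positivity
    have h6 : 0 ≤ e * l := mul_nonneg (by linarith) (by linarith)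
    nlinarith

theorem exists_pos_le_of_finset {ι : Type*} (s : Finset ι) {f : ι → ℝ} (hf : ∀ i ∈ s, 0 < f i) :
    ∃ δ : ℝ, 0 < δ ∧ ∀ i ∈ s, δ ≤ f i := by
  have h : ∀ᶠ δ in 𝓝[>] (0 : ℝ), ∀ i ∈ s, δ ≤ f i :=
    (Finset.eventually_all s).2 fun i hi =>
      ((eventually_le_nhds (hf i hi)).filter_mono nhdsWithin_le_nhds)
  obtain ⟨δ, h1, h2⟩ := (h.and self_mem_nhdsWithin).exists
  exact ⟨δ, h2, h1⟩

theorem exists_separation {d : ℕ} (G : Finset (Fin d → ℝ)) :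
    ∃ δ : ℝ, 0 < δ ∧ ∀ g ∈ G, ∀ g' ∈ G, g' ≠ g → 2 * δ ≤ ‖g' - g‖ := by
  classical
  obtain ⟨δ, hδ, h⟩ := exists_pos_le_of_finset G.offDiag (f := fun q => ‖q.1 - q.2‖ / 2)
    fun q hq => by
      have := norm_pos_iff.2 (sub_ne_zero.2 (Finset.mem_offDiag.1 hq).2.2)
      positivity
  refine ⟨δ, hδ, fun g hg g' hg' hne => ?_⟩
  have := h (g', g) (Finset.mem_offDiag.2 ⟨hg', hg, hne⟩)
  simp only at this
  linarith

/-- Approximation of the frequency map when its singular points are removable, with interpolation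
of its extension at finitely many points. -/
theorem exists_network_removable (d k : ℕ) (hd : 1 ≤ d) (hk : 1 ≤ k) (ρ : ℝ) :
    ∃ c : ℝ, 0 < c ∧ ∀ (S : Set (Fin d → ℝ)), Convex ℝ S → (interior S).Nonempty →
      Bornology.IsBounded S → Metric.diam S ≤ ρ → ∀ (E G : Finset (Fin d → ℝ)),
      (2 ≤ d ∨ E = ∅) → (G : Set (Fin d → ℝ)) ⊆ S → ∀ α : (Fin d → ℝ) → ℝ,
      ContinuousOn α (S \ E) → ∀ A₀ A₁ : ℝ, A₀ ≤ A₁ → (∀ s ∈ S \ E, α s ∈ Icc A₀ A₁) →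
      SobolevNormLE k (interior S \ E) α 1 →
      ∃ v : (Fin d → ℝ) → ℝ, ∀ ε : ℝ, 0 < ε → ε ≤ 1 / 2 → ∃ F : ReLUNetwork d,
        (F.depth : ℝ) ≤ c * Real.log (1 / ε) ∧
        (F.size : ℝ) ≤ c * (ε ^ (-(d : ℝ) / (k : ℝ)) * Real.log (1 / ε) + G.card) ∧
        (∀ x, F.eval x ∈ Icc A₀ A₁) ∧ (∀ g ∈ G, F.eval g = v g) ∧
        ∀ s ∈ S \ E, |F.eval s - α s| ≤ ε := by
  set ρ' : ℝ := max 1 ρ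
  have hρ' : 1 ≤ ρ' := le_max_left _ _
  obtain ⟨c₀, hc₀, hnet⟩ := exists_network_of_jets d k hρ'
  obtain ⟨K, hK, hpar⟩ := exists_parameters d k hd hk hρ' hc₀
  refine ⟨K, hK, fun S hS hint hbdd hdiam E G hE hGS α hα A₀ A₁ hA hJ hW => ?_⟩
  obtain ⟨β, hβα, hβJ, hdense, hjet⟩ := exists_extension hd hk hS hint hbdd hE hα hJ hW
  refine ⟨β, fun ε hε hε2 => ?_⟩
  obtain ⟨m, h, h0, herr, hm, hdep, hsize⟩ := hpar ε hε hε2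
  obtain ⟨δ, hδ, hGδ⟩ := exists_separation G
  obtain ⟨p, hp⟩ := hint.mono interior_subset
  have hxp : ∀ x ∈ S, ∀ i, |x i - p i| ≤ ρ' := fun x hx i => by
    have h1 : ‖x - p‖ ≤ ρ' := by
      rw [← dist_eq_norm]
      exact ((Metric.dist_le_diam_of_mem hbdd hx hp).trans hdiam).trans (le_max_right _ _)
    exact (norm_le_pi_norm (x - p) i).trans h1
  let z : Fin d → (Fin d → ℝ) → ℝ := fun i x => h⁻¹ * (x i - p i)
  have hz : ∀ i, Continuous (z i) := fun i => by fun_prop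
  obtain ⟨F, h1, h2, h3, h4, h5⟩ := hnet S p z (-(ρ' / h)) (ρ' / h) m 0 (inputs d) β β G A₀ A₁ δ
    (ε / 4) hxp (by linarith [div_pos (by linarith : 0 < ρ') h0]) (fun x hx i => by
      have := hxp x hx i
      rw [mem_Icc, ← abs_le]
      simp only [z]
      rw [abs_mul, abs_of_pos (inv_pos.2 h0), div_eq_inv_mul]
      gcongr) (fun c x₁ hx₁ hc => by
      have hopen : IsOpen {x : Fin d → ℝ | ∀ i, |z i x - c i| < 1} := by
        simp only [ofPred_forall]
        exact isOpen_iInter_of_finite fun i =>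
          isOpen_lt ((hz i).sub continuous_const).abs continuous_const
      obtain ⟨x₀, hx₀, hx₀S⟩ := mem_closure_iff.1 (hdense hx₁) _ hopen hc
      obtain ⟨a, ha, hax⟩ := hjet x₀ hx₀S
      refine ⟨x₀, hx₀S.1, a, ha, fun x hx hxc => (hax x hx).trans (le_trans ?_ herr)⟩
      have hnorm : ‖x - x₀‖ ≤ 2 * h := by
        rw [pi_norm_le_iff_of_nonneg (by positivity)]
        intro i
        have e1 := abs_lt.1 (hxc i)
        have e2 := abs_lt.1 (hx₀ i)
        have e3 : x i - x₀ i = h * (z i x - z i x₀) := by simp only [z]; field_simp; ring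
        rw [Pi.sub_apply, e3, Real.norm_eq_abs, abs_mul, abs_of_pos h0, mul_comm]
        gcongr
        exact abs_le.2 ⟨by linarith, by linarith⟩
      gcongr) (fun D _ => .refl)
    (fun i => (((AffComb.of_mem (show ((fun x : Fin d → ℝ => x i), 0) ∈ inputs d from ⟨i, rfl⟩)
      (Nat.zero_le _)).add_const (-p i)).const_mul h⁻¹).mono subset_rfl le_rfl (by omega)) hA hβJ (fun g hg => hβJ g (hGS hg)) hδ hGδ
    (fun g hg => .inl ⟨hGS hg, rfl⟩)
  refine ⟨F, h1.trans hdep, h2.trans ?_, h3, h4, fun s hs => ?_⟩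
  · refine le_trans ?_ (hsize G.card (Nat.cast_nonneg _))
    have e1 : (ρ' / h - -(ρ' / h) + 3) = 2 * ρ' / h + 3 := by ring
    rw [e1]
    refine mul_le_mul_of_nonneg_left ?_ hc₀.le
    have := (Nat.cast_nonneg m : (0 : ℝ) ≤ m)
    have := (Nat.cast_nonneg G.card : (0 : ℝ) ≤ G.card)
    push_cast
    linarith
  · rw [← hβα s hs]
    refine (h5 s hs.1).trans ?_
    linarith

/-! ### Jumps in dimension one -/

/-- The piecewise linear step from `0` to `1` on `[-δ, δ]`. -/
def step (δ u : ℝ) : ℝ := (2 * δ)⁻¹ * (max 0 (u + δ) - max 0 (u - δ))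

theorem step_mono {δ : ℝ} (hδ : 0 < δ) : Monotone (step δ) := by
  intro u v huv
  refine mul_le_mul_of_nonneg_left ?_ (by positivity)
  rcases max_cases 0 (u + δ) with ⟨h1, _⟩ | ⟨h1, _⟩ <;>
  rcases max_cases 0 (v + δ) with ⟨h2, _⟩ | ⟨h2, _⟩ <;>
  rcases max_cases 0 (u - δ) with ⟨h3, _⟩ | ⟨h3, _⟩ <;>
  rcases max_cases 0 (v - δ) with ⟨h4, _⟩ | ⟨h4, _⟩ <;>
  rw [h1, h2, h3, h4] <;> linarith

theorem step_of_le {δ u : ℝ} (hδ : 0 < δ) (h : u ≤ -δ) : step δ u = 0 := by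
  rw [step, max_eq_left (by linarith), max_eq_left (by linarith), sub_zero, mul_zero]

theorem step_of_ge {δ u : ℝ} (hδ : 0 < δ) (h : δ ≤ u) : step δ u = 1 := by
  rw [step, max_eq_right (by linarith), max_eq_right (by linarith)]
  field_simp
  ring

theorem step_mem_Icc {δ : ℝ} (hδ : 0 < δ) (u : ℝ) : step δ u ∈ Icc (0 : ℝ) 1 := by
  constructor
  · rw [← step_of_le hδ (min_le_right u (-δ))]
    exact step_mono hδ (min_le_left _ _)
  · rw [← step_of_ge hδ (le_max_right u δ)]
    exact step_mono hδ (le_max_left _ _)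

/-- The coordinate `h⁻¹ (x_i - p_i)` with an additional rise by `2` at each point of `E`. Points on
different sides of a point of `E` never lie in a common unit cell of this feature. -/
def jumpFeature {d : ℕ} (E : Finset (Fin d → ℝ)) (p : Fin d → ℝ) (h δ : ℝ) (i : Fin d)
    (x : Fin d → ℝ) : ℝ :=
  h⁻¹ * (x i - p i) + 2 * ∑ e ∈ E, step δ (x i - e i)

theorem Extends.mono_depth {d D D' n : ℕ} {L L' : Set (((Fin d → ℝ) → ℝ) × ℕ)}
    (h : Extends D L L' n) (hD : D ≤ D') : Extends D' L L' n := by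
  induction h with
  | refl => exact .refl
  | unit _ hf hℓ ih => exact ih.unit hf (hℓ.trans hD)
  | mono _ hn ih => exact ih.mono hn

theorem exists_jumpFeature {d D : ℕ} (E : Finset (Fin d → ℝ)) (p : Fin d → ℝ) (h δ : ℝ)
    (hD : 2 ≤ D) :
    ∃ L, Extends D (inputs d) L (d * (E.card * 4 + 2 * (2 * E.card + 2))) ∧
      ∀ i, AffComb L 2 2 (jumpFeature E p h δ i) := by
  have key := exists_extends_forall (D := D) (L := inputs d)
    (n := E.card * 4 + 2 * (2 * E.card + 2)) (Finset.univ : Finset (Fin d))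
    (Q := fun i L' => AffComb L' 2 2 (jumpFeature E p h δ i))
    (fun _ _ _ hLL h => h.mono hLL le_rfl le_rfl) (fun i _ L hL => by
      have hi : ((fun x : Fin d → ℝ => x i), 0) ∈ L := hL ⟨i, rfl⟩
      have hx : ∀ L', L ⊆ L' → AffComb L' 0 1 (fun x : Fin d → ℝ => x i) := fun L' hL' =>
        .of_mem (hL' hi) le_rfl
      obtain ⟨L₁, h₁, hs⟩ := exists_extends_forall (D := D) (L := L) (n := 4) E
        (Q := fun e L' => AffComb L' 1 2 (fun x : Fin d → ℝ => step δ (x i - e i)))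
        (fun _ _ _ hLL h => h.mono hLL le_rfl le_rfl) (fun e _ L₁ hL₁ => by
          obtain ⟨L₂, h₂, hf₂⟩ := ((hx L₁ hL₁).add_const (-e i + δ)).exists_relu (D := D) (by omega)
          obtain ⟨L₃, h₃, hf₃⟩ := ((hx L₂ (hL₁.trans h₂.subset)).add_const
            (-e i - δ)).exists_relu (D := D) (by omega)
          refine ⟨L₃, (h₂.trans h₃).mono (by omega), (((hf₂.mono h₃.subset le_rfl
            le_rfl).add_comb (hf₃.const_mul (-1))).const_mul (2 * δ)⁻¹).congr fun x => ?_⟩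
          rw [step]
          ring_nf)
      have hall : AffComb L₁ 1 (2 * E.card + 1) (jumpFeature E p h δ i) := by
        have h1 := (AffComb.sum E hs (fun _ => 1)).const_mul 2
        have h2 := (((hx L₁ h₁.subset).add_const (-p i)).const_mul h⁻¹).mono subset_rfl
          (Nat.zero_le 1) le_rfl
        refine ((h2.add_comb h1).mono subset_rfl le_rfl (by omega)).congr fun x => ?_
        simp only [jumpFeature, one_mul]
        ring
      obtain ⟨L₂, h₂, hf₂⟩ := hall.exists_store (D := D) hD
      exact ⟨L₂, (h₁.trans h₂).mono (by omega), hf₂⟩)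
  obtain ⟨L, h1, h2⟩ := key
  exact ⟨L, by simpa using h1, fun i => h2 i (Finset.mem_univ i)⟩

/-- The feature grows at least like the rescaled coordinate, and by at least `2` across a point of
`E` at distance at least `δ`. -/
theorem jumpFeature_sub_ge {d : ℕ} {E : Finset (Fin d → ℝ)} {p : Fin d → ℝ} {h δ : ℝ} (hh : 0 < h)
    (hδ : 0 < δ) {i : Fin d} {x y : Fin d → ℝ} (hxy : x i ≤ y i) :
    h⁻¹ * (y i - x i) ≤ jumpFeature E p h δ i y - jumpFeature E p h δ i x ∧
      ∀ e ∈ E, x i + δ ≤ e i → e i + δ ≤ y i →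
        2 ≤ jumpFeature E p h δ i y - jumpFeature E p h δ i x := by
  have hdiff : jumpFeature E p h δ i y - jumpFeature E p h δ i x =
      h⁻¹ * (y i - x i) + 2 * ∑ e ∈ E, (step δ (y i - e i) - step δ (x i - e i)) := by
    rw [jumpFeature, jumpFeature, Finset.sum_sub_distrib]
    ring
  have hnn : ∀ e ∈ E, 0 ≤ step δ (y i - e i) - step δ (x i - e i) := fun e _ =>
    sub_nonneg.2 (step_mono hδ (by linarith))
  have hpos : 0 ≤ h⁻¹ * (y i - x i) := mul_nonneg (inv_pos.2 hh).le (by linarith)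
  rw [hdiff]
  refine ⟨by linarith [Finset.sum_nonneg hnn], fun e he h1 h2 => ?_⟩
  have h3 := Finset.single_le_sum hnn he
  rw [step_of_ge hδ (by linarith), step_of_le hδ (by linarith)] at h3
  linarith

/-- In dimension one, points of a common cell of the jump feature are close, and no exceptional
point separates them. -/
theorem close_of_common_cell {E : Finset (Fin 1 → ℝ)} {p : Fin 1 → ℝ} {h δ : ℝ} (hh : 0 < h) (hδ : 0 < δ)
    {x y : Fin 1 → ℝ} (hx : ∀ e ∈ E, δ ≤ ‖x - e‖) (hy : ∀ e ∈ E, δ ≤ ‖y - e‖)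
    (hlt : |jumpFeature E p h δ 0 x - jumpFeature E p h δ 0 y| < 2) :
    ‖x - y‖ ≤ 2 * h ∧ ∀ e ∈ E, e ∉ segment ℝ y x := by
  have hnorm : ∀ w : Fin 1 → ℝ, ‖w‖ = |w 0| := fun w => by
    refine le_antisymm ((pi_norm_le_iff_of_nonneg (abs_nonneg _)).2 fun i => ?_)
      (norm_le_pi_norm w 0)
    rw [Subsingleton.elim i 0, Real.norm_eq_abs]
  have hmono : ∀ u w : Fin 1 → ℝ, (∀ e ∈ E, δ ≤ ‖u - e‖) → (∀ e ∈ E, δ ≤ ‖w - e‖) → u 0 ≤ w 0 →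
      jumpFeature E p h δ 0 w - jumpFeature E p h δ 0 u < 2 →
      w 0 - u 0 ≤ 2 * h ∧ ∀ e ∈ E, ¬ (u 0 ≤ e 0 ∧ e 0 ≤ w 0) := by
    intro u w hu hw huw hd
    obtain ⟨h1, h2⟩ := jumpFeature_sub_ge (E := E) (p := p) hh hδ huw
    refine ⟨?_, fun e he ⟨h3, h4⟩ => ?_⟩
    · have h3 := h1.trans hd.le
      rw [inv_mul_le_iff₀ hh] at h3
      linarith
    · have h5 := hu e he
      have h6 := hw e he
      rw [hnorm, Pi.sub_apply, abs_of_nonpos (by linarith)] at h5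
      rw [hnorm, Pi.sub_apply, abs_of_nonneg (by linarith)] at h6
      exact absurd (h2 e he (by linarith) (by linarith)) (not_le.2 hd)
  obtain ⟨h1, h2⟩ := abs_lt.1 hlt
  have hseg : ∀ e ∈ segment ℝ y x, min (y 0) (x 0) ≤ e 0 ∧ e 0 ≤ max (y 0) (x 0) := by
    rintro e ⟨s, t, hs, ht, hst, rfl⟩
    have : (s • y + t • x) 0 ∈ segment ℝ (y 0) (x 0) := ⟨s, t, hs, ht, hst, rfl⟩
    rw [segment_eq_uIcc] at this
    exact this
  rcases le_total (y 0) (x 0) with hle | hle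
  · obtain ⟨h3, h4⟩ := hmono y x hy hx hle (by linarith)
    refine ⟨by rw [hnorm, Pi.sub_apply, abs_of_nonneg (by linarith)]; exact h3, fun e he hes => ?_⟩
    have := hseg e hes
    rw [min_eq_left hle, max_eq_right hle] at this
    exact h4 e he this
  · obtain ⟨h3, h4⟩ := hmono x y hx hy hle (by linarith)
    refine ⟨by rw [hnorm, Pi.sub_apply, abs_of_nonpos (by linarith)]; linarith, fun e he hes => ?_⟩
    have := hseg e hes
    rw [min_eq_right hle, max_eq_left hle] at this
    exact h4 e he this

/-- Approximation of the frequency map of one variable away from its singular points, with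
prescribed values at the singular points. -/
theorem exists_network_of_dim_one (k : ℕ) (hk : 1 ≤ k) (ρ : ℝ) :
    ∃ c : ℝ, 0 < c ∧ ∀ (S : Set (Fin 1 → ℝ)), Convex ℝ S → (interior S).Nonempty →
      Bornology.IsBounded S → Metric.diam S ≤ ρ → ∀ (E G : Finset (Fin 1 → ℝ)), E ⊆ G →
      (G : Set (Fin 1 → ℝ)) ⊆ S → ∀ α : (Fin 1 → ℝ) → ℝ,
      ContinuousOn α (S \ E) → ∀ A₀ A₁ : ℝ, A₀ ≤ A₁ → (∀ s ∈ S \ E, α s ∈ Icc A₀ A₁) →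
      SobolevNormLE k (interior S \ E) α 1 →
      ∀ v : (Fin 1 → ℝ) → ℝ, (∀ g ∈ G, v g ∈ Icc A₀ A₁) → (∀ g ∈ G, g ∉ E → v g = α g) →
        ∀ ε : ℝ, 0 < ε → ε ≤ 1 / 2 → ∀ K : Set (Fin 1 → ℝ), IsCompact K → K ⊆ S \ E →
        ∃ F : ReLUNetwork 1,
          (F.depth : ℝ) ≤ c * Real.log (1 / ε) ∧
          (F.size : ℝ) ≤ c * (ε ^ (-((1 : ℕ) : ℝ) / (k : ℝ)) * Real.log (1 / ε) + G.card) ∧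
          (∀ x, F.eval x ∈ Icc A₀ A₁) ∧ (∀ g ∈ G, F.eval g = v g) ∧
          ∀ s ∈ K, |F.eval s - α s| ≤ ε := by
  set ρ' : ℝ := max 1 ρ
  have hρ' : 1 ≤ ρ' := le_max_left _ _
  obtain ⟨c₀, hc₀, hnet⟩ := exists_network_of_jets 1 k hρ'
  obtain ⟨K₀, hK₀, hpar⟩ := exists_parameters 1 k le_rfl hk hρ' hc₀
  refine ⟨K₀, hK₀, fun S hS hint hbdd hdiam E G hEG hGS α hα A₀ A₁ hA hJ hW v hv hvα ε hε hε2 K hK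
    hKS => ?_⟩
  obtain ⟨m, h, h0, herr, hm, hdep, hsize⟩ := hpar ε hε hε2
  -- the network is also to be accurate at the points of `G` outside `E`
  let X : Set (Fin 1 → ℝ) := K ∪ ((G : Set (Fin 1 → ℝ)) \ E)
  have hXS : X ⊆ S \ E := union_subset hKS fun g hg => ⟨hGS hg.1, hg.2⟩
  have hXc : IsCompact X := hK.union (G.finite_toSet.subset sdiff_subset).isCompact
  obtain ⟨δ₁, hδ₁, hGδ⟩ := exists_separation G
  obtain ⟨δ₂, hδ₂, hEδ⟩ : ∃ δ : ℝ, 0 < δ ∧ ∀ x ∈ X, ∀ e ∈ E, δ ≤ ‖x - e‖ := by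
    have hdisj : Disjoint X (E : Set (Fin 1 → ℝ)) :=
      disjoint_left.2 fun x hx he => (hXS hx).2 he
    obtain ⟨δ, hδ, hd⟩ := hdisj.exists_thickenings hXc E.finite_toSet.isClosed
    refine ⟨δ, hδ, fun x hx e he => ?_⟩
    by_contra! hlt
    rw [← dist_eq_norm, dist_comm] at hlt
    exact disjoint_left.1 hd (Metric.mem_thickening_iff.2 ⟨x, hx, hlt⟩)
      (Metric.self_subset_thickening hδ _ he)
  let δ : ℝ := min δ₁ δ₂
  have hδ : 0 < δ := lt_min hδ₁ hδ₂
  obtain ⟨p, hp⟩ := hint.mono interior_subset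
  have hxp : ∀ x ∈ X, ∀ i, |x i - p i| ≤ ρ' := fun x hx i => by
    have h1 : ‖x - p‖ ≤ ρ' := by
      rw [← dist_eq_norm]
      exact ((Metric.dist_le_diam_of_mem hbdd (hXS hx).1 hp).trans hdiam).trans (le_max_right _ _)
    exact (norm_le_pi_norm (x - p) i).trans h1
  have hM : ∀ s ∈ S \ E, |α s| ≤ max |A₀| |A₁| := fun s hs =>
    abs_le_max_abs_abs (hJ s hs).1 (hJ s hs).2
  obtain ⟨L, hL, hLz⟩ := exists_jumpFeature E p h δ (le_refl 2)
  have hcell : ∀ x ∈ X, ∀ y ∈ X, ∀ c : Fin 1 → ℤ, (∀ i, |jumpFeature E p h δ i x - c i| < 1) →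
      (∀ i, |jumpFeature E p h δ i y - c i| < 1) →
      ‖x - y‖ ≤ 2 * h ∧ ∀ e ∈ E, e ∉ segment ℝ y x := by
    intro x hx y hy c hxc hyc
    refine close_of_common_cell (p := p) h0 hδ (fun e he => (min_le_right _ _).trans (hEδ x hx e he))
      (fun e he => (min_le_right _ _).trans (hEδ y hy e he)) ?_
    have h1 := abs_lt.1 (hxc 0)
    have h2 := abs_lt.1 (hyc 0)
    exact abs_lt.2 ⟨by linarith, by linarith⟩
  have hdiv : 0 < ρ' / h := div_pos (by linarith) h0
  have hcard : (0 : ℝ) ≤ E.card := Nat.cast_nonneg _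
  obtain ⟨F, h1, h2, h3, h4, h5⟩ := hnet X p (jumpFeature E p h δ) (-(ρ' / h))
    (ρ' / h + 2 * E.card) m (1 * (E.card * 4 + 2 * (2 * E.card + 2))) L α v G A₀ A₁ δ (ε / 4) hxp
    (by linarith) (fun x hx i => by
      have e1 : |h⁻¹ * (x i - p i)| ≤ ρ' / h := by
        rw [abs_mul, abs_of_pos (inv_pos.2 h0), div_eq_inv_mul]
        exact mul_le_mul_of_nonneg_left (hxp x hx i) (inv_pos.2 h0).le
      have e2 : 0 ≤ ∑ e ∈ E, step δ (x i - e i) :=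
        Finset.sum_nonneg fun e _ => (step_mem_Icc hδ _).1
      have e3 : ∑ e ∈ E, step δ (x i - e i) ≤ E.card := by
        calc _ ≤ ∑ _e ∈ E, (1 : ℝ) := Finset.sum_le_sum fun e _ => (step_mem_Icc hδ _).2
          _ = E.card := by simp
      have e4 := abs_le.1 e1
      rw [jumpFeature]
      constructor <;> linarith [e4.1, e4.2])
    (fun c x₁ hx₁ hc => by
      obtain ⟨a, ha, hax⟩ := exists_jet hk hS hint hbdd hα hM hW (hXS hx₁).1
      refine ⟨x₁, hx₁, a, ha, fun x hx hxc => ?_⟩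
      obtain ⟨e1, e2⟩ := hcell x hx x₁ hx₁ c hxc hc
      refine (hax x (hXS hx).1 e2).trans (le_trans ?_ herr)
      gcongr)
    (fun D hD => hL.mono_depth hD) hLz hA (fun x hx => hJ x (hXS hx)) hv hδ
    (fun g hg g' hg' hne => by
      have e1 := hGδ g hg g' hg' hne
      have e2 : δ ≤ δ₁ := min_le_left _ _
      linarith)
    (fun g hg => by
      by_cases hgE : g ∈ E
      · exact .inr fun x hx => (min_le_right _ _).trans (hEδ x hx g hgE)
      · exact .inl ⟨.inr ⟨hg, hgE⟩, hvα g hg hgE⟩)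
  refine ⟨F, h1.trans hdep, h2.trans ?_, h3, h4, fun s hs => ?_⟩
  · refine le_trans ?_ (hsize G.card (Nat.cast_nonneg _))
    refine mul_le_mul_of_nonneg_left ?_ hc₀.le
    have e1 : (E.card : ℝ) ≤ G.card := by exact_mod_cast Finset.card_le_card hEG
    have e2 := (Nat.cast_nonneg m : (0 : ℝ) ≤ m)
    rw [pow_one, pow_one, mul_div_assoc]
    push_cast
    linarith
  · refine (h5 s (.inl hs)).trans ?_
    linarith

/-! ### The network for the frequency map and the reconstruction error -/

/-- The network theorem for the frequency map. The values `v` at the points of `G` do not depend on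
the accuracy, and the error at the points where accuracy is not guaranteed is controlled by the
deviation of `v` from `α`. -/
theorem exists_frequency_network (d k : ℕ) (hd : 1 ≤ d) (hk : 1 ≤ k) (ρ : ℝ) :
    ∃ c : ℝ, 0 < c ∧ ∀ (S : Set (Fin d → ℝ)), Convex ℝ S → (interior S).Nonempty →
      Bornology.IsBounded S → Metric.diam S ≤ ρ → ∀ (E G : Finset (Fin d → ℝ)), E ⊆ G →
      (G : Set (Fin d → ℝ)) ⊆ S → ∀ α : (Fin d → ℝ) → ℝ,
      ContinuousOn α (S \ E) → ∀ A₀ A₁ : ℝ, A₀ ≤ A₁ → (∀ s ∈ S \ E, α s ∈ Icc A₀ A₁) →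
      SobolevNormLE k (interior S \ E) α 1 →
      ∃ v : (Fin d → ℝ) → ℝ, ∀ ε : ℝ, 0 < ε → ε ≤ 1 / 2 →
        ∀ K : Set (Fin d → ℝ), IsCompact K → K ⊆ S \ E → ∃ F : ReLUNetwork d,
          (F.depth : ℝ) ≤ c * Real.log (1 / ε) ∧
          (F.size : ℝ) ≤ c * (ε ^ (-(d : ℝ) / (k : ℝ)) * Real.log (1 / ε) + G.card) ∧
          (∀ x, F.eval x ∈ Icc A₀ A₁) ∧ (∀ g ∈ G, F.eval g = v g) ∧
          (∀ s ∈ S \ E, 2 ≤ d ∨ s ∈ K → |F.eval s - α s| ≤ ε) ∧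
          ∀ s ∈ S \ E, |F.eval s - α s| ≤ ε + 2 * ∑ g ∈ G, |v g - α g| := by
  obtain ⟨c₁, hc₁, h₁⟩ := exists_network_removable d k hd hk ρ
  rcases eq_or_ne d 1 with rfl | hne
  · obtain ⟨c₂, hc₂, h₂⟩ := exists_network_of_dim_one k hk ρ
    refine ⟨max c₁ c₂, lt_max_of_lt_left hc₁, fun S hS hint hbdd hdiam E G hEG hGS α hα A₀ A₁ hA hJ
      hW => ?_⟩
    rcases E.eq_empty_or_nonempty with hE | ⟨e₀, he₀⟩
    · obtain ⟨v, h⟩ := h₁ S hS hint hbdd hdiam E G (.inr hE) hGS α hα A₀ A₁ hA hJ hW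
      refine ⟨v, fun ε hε hε2 K _ _ => ?_⟩
      obtain ⟨F, hdep, hsize, hF1, hF2, hF3⟩ := h ε hε hε2
      have hl := half_le_log_inv hε hε2
      have hsum : 0 ≤ ∑ g ∈ G, |v g - α g| := Finset.sum_nonneg fun _ _ => abs_nonneg _
      refine ⟨F, hdep.trans ?_, hsize.trans ?_, hF1, hF2, fun s hs _ => hF3 s hs, fun s hs =>
        (hF3 s hs).trans (by linarith)⟩
      · gcongr
        exact le_max_left _ _
      · gcongr
        exact le_max_left _ _
    · -- at the points of `E` the endpoint of `[A₀, A₁]` farther from `α` is prescribed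
      let v : (Fin 1 → ℝ) → ℝ := fun g =>
        if g ∈ E then (if α g ≤ (A₀ + A₁) / 2 then A₁ else A₀) else α g
      refine ⟨v, fun ε hε hε2 K hK hKS => ?_⟩
      obtain ⟨F, hdep, hsize, hF1, hF2, hF3⟩ := h₂ S hS hint hbdd hdiam E G hEG hGS α hα A₀ A₁ hA
        hJ hW v (fun g hg => by
          by_cases hgE : g ∈ E
          · simp only [v, if_pos hgE]
            split_ifs
            · exact right_mem_Icc.2 hA
            · exact left_mem_Icc.2 hA
          · simp only [v, if_neg hgE]
            exact hJ g ⟨hGS hg, hgE⟩)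
        (fun g _ hgE => by simp only [v, if_neg hgE]) ε hε hε2 K hK hKS
      have hl := half_le_log_inv hε hε2
      refine ⟨F, hdep.trans ?_, hsize.trans ?_, hF1, hF2, fun s hs h => hF3 s (by
        rcases h with h | h
        · omega
        · exact h), fun s hs => ?_⟩
      · gcongr
        exact le_max_right _ _
      · gcongr
        exact le_max_right _ _
      · have e1 : (A₁ - A₀) / 2 ≤ |v e₀ - α e₀| := by
          simp only [v, if_pos he₀]
          split_ifs with h
          · exact (le_abs_self _).trans' (by linarith)
          · rw [abs_sub_comm]
            exact (le_abs_self _).trans' (by linarith)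
        have e2 : |v e₀ - α e₀| ≤ ∑ g ∈ G, |v g - α g| :=
          Finset.single_le_sum (f := fun g => |v g - α g|) (fun _ _ => abs_nonneg _) (hEG he₀)
        have e3 := hF1 s
        have e4 := hJ s hs
        have e5 : |F.eval s - α s| ≤ A₁ - A₀ :=
          abs_le.2 ⟨by linarith [e3.1, e4.2], by linarith [e3.2, e4.1]⟩
        linarith
  · refine ⟨c₁, hc₁, fun S hS hint hbdd hdiam E G _ hGS α hα A₀ A₁ hA hJ hW => ?_⟩
    obtain ⟨v, h⟩ := h₁ S hS hint hbdd hdiam E G (.inl (by omega)) hGS α hα A₀ A₁ hA hJ hW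
    refine ⟨v, fun ε hε hε2 K _ _ => ?_⟩
    obtain ⟨F, hdep, hsize, hF1, hF2, hF3⟩ := h ε hε hε2
    have hsum : 0 ≤ ∑ g ∈ G, |v g - α g| := Finset.sum_nonneg fun _ _ => abs_nonneg _
    exact ⟨F, hdep, hsize, hF1, hF2, fun s hs _ => hF3 s hs, fun s hs =>
      (hF3 s hs).trans (by linarith)⟩

theorem supNorm_sub_le (T₀ T₁ : ℝ) (u v w : ℝ → ℝ) :
    supNorm T₀ T₁ (u - w) ≤ supNorm T₀ T₁ (u - v) + supNorm T₀ T₁ (v - w) := by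
  rw [← sub_add_sub_cancel u v w]
  simp only [supNorm, eLpNorm_exponent_top]
  exact eLpNormEssSup_add_le

theorem supNorm_sub_self (T₀ T₁ : ℝ) (u : ℝ → ℝ) : supNorm T₀ T₁ (u - u) = 0 := by
  simp [supNorm]

theorem supNorm_ne_top {T₀ T₁ : ℝ} {u : ℝ → ℝ} (hu : Continuous u) : supNorm T₀ T₁ u ≠ ⊤ := by
  obtain ⟨C, hC⟩ := isCompact_Icc.exists_bound_of_continuousOn (s := Icc T₀ T₁) hu.continuousOn
  rw [supNorm, eLpNorm_exponent_top]
  refine (lt_of_le_of_lt (eLpNormEssSup_le_of_ae_bound (C := C) ?_) ENNReal.ofReal_lt_top).ne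
  filter_upwards [ae_restrict_mem measurableSet_Icc] with t ht
  exact hC t ht

/-- On an interval, local Lipschitz continuity in the parameter is global. -/
theorem LocallyLipschitzInParam.lipschitzInParam {T₀ T₁ L A₀ A₁ : ℝ} {u : ℝ → ℝ → ℝ}
    (h : LocallyLipschitzInParam T₀ T₁ L u (Icc A₀ A₁)) (hL : 0 ≤ L) :
    LipschitzInParam T₀ T₁ L u (Icc A₀ A₁) := by
  have hloc : ∀ β : Icc A₀ A₁, ∃ r > 0, LipschitzInParam T₀ T₁ L u
      (Metric.ball (β : ℝ) r ∩ Icc A₀ A₁) := fun β => by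
    obtain ⟨V, hV, hVL⟩ := h β β.2
    obtain ⟨r, hr, hrV⟩ := Metric.mem_nhdsWithin_iff.1 hV
    exact ⟨r, hr, fun β₁ h₁ β₂ h₂ => hVL β₁ (hrV h₁) β₂ (hrV h₂)⟩
  choose r hr hrL using hloc
  obtain ⟨δ, hδ, hball⟩ := lebesgue_number_lemma_of_metric
    (c := fun β : Icc A₀ A₁ => Metric.ball (β : ℝ) (r β)) isCompact_Icc
    (fun _ => Metric.isOpen_ball) fun β hβ => mem_iUnion.2 ⟨⟨β, hβ⟩, Metric.mem_ball_self (hr _)⟩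
  have hshort : ∀ β₁ ∈ Icc A₀ A₁, ∀ β₂ ∈ Icc A₀ A₁, |β₁ - β₂| < δ →
      supNorm T₀ T₁ (u β₁ - u β₂) ≤ ENNReal.ofReal (L * |β₁ - β₂|) := by
    intro β₁ h₁ β₂ h₂ hd
    obtain ⟨β, hβ⟩ := hball β₁ h₁
    refine hrL β β₁ ⟨hβ (Metric.mem_ball_self hδ), h₁⟩ β₂ ⟨hβ ?_, h₂⟩
    rw [Metric.mem_ball, dist_comm]
    exact hd
  have hchain : ∀ n : ℕ, ∀ β₁ ∈ Icc A₀ A₁, ∀ β₂ ∈ Icc A₀ A₁, |β₁ - β₂| ≤ 2 ^ n * (δ / 2) →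
      supNorm T₀ T₁ (u β₁ - u β₂) ≤ ENNReal.ofReal (L * |β₁ - β₂|) := by
    intro n
    induction n with
    | zero =>
      intro β₁ h₁ β₂ h₂ hd
      exact hshort β₁ h₁ β₂ h₂ (by rw [pow_zero, one_mul] at hd; linarith)
    | succ n ih =>
      intro β₁ h₁ β₂ h₂ hd
      have hmid : (β₁ + β₂) / 2 ∈ Icc A₀ A₁ :=
        ⟨by linarith [h₁.1, h₂.1], by linarith [h₁.2, h₂.2]⟩
      have e1 : |β₁ - (β₁ + β₂) / 2| = |β₁ - β₂| / 2 := by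
        rw [show β₁ - (β₁ + β₂) / 2 = (β₁ - β₂) / 2 by ring, abs_div, abs_two]
      have e2 : |(β₁ + β₂) / 2 - β₂| = |β₁ - β₂| / 2 := by
        rw [show (β₁ + β₂) / 2 - β₂ = (β₁ - β₂) / 2 by ring, abs_div, abs_two]
      have hd' : |β₁ - β₂| / 2 ≤ 2 ^ n * (δ / 2) := by rw [pow_succ] at hd; linarith
      have i1 := ih β₁ h₁ _ hmid (e1.trans_le hd')
      have i2 := ih _ hmid β₂ h₂ (e2.trans_le hd')
      rw [e1] at i1
      rw [e2] at i2
      refine (supNorm_sub_le T₀ T₁ _ (u ((β₁ + β₂) / 2)) _).trans ((add_le_add i1 i2).trans ?_)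
      rw [← ENNReal.ofReal_add (by positivity) (by positivity)]
      exact ENNReal.ofReal_le_ofReal (by linarith)
  intro β₁ h₁ β₂ h₂
  obtain ⟨n, hn⟩ := pow_unbounded_of_one_lt (|β₁ - β₂| / (δ / 2)) one_lt_two
  exact hchain n β₁ h₁ β₂ h₂ ((div_le_iff₀ (by positivity)).1 hn.le)

theorem IsHPSpline.continuous {d m : ℕ} {ξ₁ h α lam : ℝ} {B : Fin (m + 2) → ℝ → ℝ}
    {t y : Fin d → ℝ} {σ : ℝ → ℝ} (hσ : IsHPSpline h α lam B t y σ)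
    (hB : IsHyperbolicBSplineBasis ξ₁ h m α B) : Continuous σ := by
  obtain ⟨a, -, rfl⟩ := hσ
  exact continuous_finsetSum _ fun j _ => continuous_const.mul (hB.contDiff j).continuous

/-- The reconstruction error is bounded by the error of the true frequency and the distance of the
two splines; no measurability of the signal is needed. -/
theorem supNorm_sub_le_add_ofReal {T₀ T₁ b : ℝ} (f : ℝ → ℝ) {u v : ℝ → ℝ}
    (h : supNorm T₀ T₁ (v - u) ≤ ENNReal.ofReal b) :
    supNorm T₀ T₁ (f - u) ≤ supNorm T₀ T₁ (f - v) + ENNReal.ofReal b :=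
  (supNorm_sub_le T₀ T₁ f v u).trans (add_le_add le_rfl h)

end

end HPS

theorem proposition1 (d k : ℕ) (hd : 1 ≤ d) (hk : 1 ≤ k) (ρ : ℝ) :
    -- the constant in the complexity bounds: it depends on `d`, `k` and the diameter bound only
    ∃ c : ℝ, 0 < c ∧
    ∀ (S : Set (Fin d → ℝ)), Convex ℝ S → (interior S).Nonempty → Bornology.IsBounded S →
      Metric.diam S ≤ ρ →
    -- the frequency map, of Sobolev norm at most 1 away from the singular points
    ∀ (α : (Fin d → ℝ) → ℝ) (E Ehp : Finset (Fin d → ℝ)), (E : Set (Fin d → ℝ)) ⊆ S →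
      (Ehp : Set (Fin d → ℝ)) ⊆ S →
      ContinuousOn α (S \ E) → HPS.SobolevNormLE k (interior S \ E) α 1 →
    -- the HP-spline model: knots, basis for each frequency, sampling times, HP-spline fits
    ∀ (ξ₁ h : ℝ) (m : ℕ) (lam : ℝ) (B : ℝ → Fin (m + 2) → ℝ → ℝ) (t : Fin d → ℝ)
      (hp : (Fin d → ℝ) → ℝ → ℝ → ℝ), 0 < h → 0 < lam →
      (∀ β, HPS.IsHyperbolicBSplineBasis ξ₁ h m β (B β)) →
      (∀ s ∈ S, ∀ β, HPS.IsHPSpline h β lam (B β) t s (hp s β)) →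
    -- a range `[A₀, A₁]` of the frequency, and the time interval `[T₀, T₁]`
    ∀ (A₀ A₁ T₀ T₁ : ℝ), A₀ ≤ A₁ → T₀ ≤ T₁ → (∀ s ∈ S \ E, α s ∈ Set.Icc A₀ A₁) →
    -- the HP-spline is locally Lipschitz in the frequency on each smooth region `R i`
    ∀ (ι : Type) [Finite ι] (R : ι → Set (Fin d → ℝ)) (L : ι → ℝ) (Lhp : ℝ),
      S \ (E ∪ Ehp : Finset (Fin d → ℝ)) ⊆ ⋃ i, R i → (∀ i, 0 < L i) →
      IsGreatest (Set.range L) Lhp →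
      (∀ i, ∀ s ∈ S ∩ R i, s ∉ E ∪ Ehp →
        HPS.LocallyLipschitzInParam T₀ T₁ (L i) (hp s) (Set.Icc A₀ A₁)) →
    -- flat ranges of the frequency
    ∀ (flat : Set (Set ℝ)) (Lflat : ℝ), 0 < Lflat →
      (∀ A ∈ flat, ∀ s ∈ S, s ∉ E ∪ Ehp → HPS.LipschitzInParam T₀ T₁ Lflat (hp s) A) →
    ∃ C : ℝ, 0 < C ∧ ∀ ε : ℝ, 0 < ε → ∀ K : Set (Fin d → ℝ), IsCompact K → K ⊆ S \ E →
      ∃ F : HPS.ReLUNetwork d,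
        -- depth and size
        (ε ≤ 1 / 2 →
          (F.depth : ℝ) ≤ c * Real.log (1 / ε) ∧
          (F.size : ℝ) ≤
            c * (ε ^ (-(d : ℝ) / (k : ℝ)) * Real.log (1 / ε) + ((E ∪ Ehp).card : ℝ))) ∧
        -- the network predicts the frequency
        (∀ s ∈ S \ E, 2 ≤ d ∨ s ∈ K → |F.eval s - α s| ≤ ε) ∧
        -- the reconstruction error, for every signal `f` with samples `s`
        (∀ s ∈ S, ∀ f : ℝ → ℝ, (∀ j, f (t j) = s j) →
          HPS.supNorm T₀ T₁ (f - hp s (F.eval s)) ≤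
            HPS.supNorm T₀ T₁ (f - hp s (α s)) +
              ENNReal.ofReal (max Lhp Lflat * ε + C * ∑ e ∈ E ∪ Ehp, |F.eval e - α e|)) ∧
        -- the same with `Lflat` when true and predicted frequencies lie in one flat range
        (∀ s ∈ S, s ∉ E ∪ Ehp → ∀ A ∈ flat, α s ∈ A → F.eval s ∈ A →
          ∀ f : ℝ → ℝ, (∀ j, f (t j) = s j) →
          HPS.supNorm T₀ T₁ (f - hp s (F.eval s)) ≤
            HPS.supNorm T₀ T₁ (f - hp s (α s)) +
              ENNReal.ofReal (Lflat * ε + C * ∑ e ∈ E ∪ Ehp, |F.eval e - α e|)) := by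
  obtain ⟨c, hc, hnet⟩ := HPS.exists_frequency_network d k hd hk ρ
  refine ⟨c, hc, ?_⟩
  intro S hS hint hbdd hdiam α E Ehp hE hEhp hα hW ξ₁ h m lam B t hp _ _ hB hspl A₀ A₁ T₀ T₁ hA _
    hJ ι _ R L Lhp hcover hL hLhp hlip flat Lflat hLflat hflat
  set G : Finset (Fin d → ℝ) := E ∪ Ehp with hGdef
  have hGS : (G : Set (Fin d → ℝ)) ⊆ S := by
    rw [hGdef, Finset.coe_union]
    exact Set.union_subset hE hEhp
  obtain ⟨v, hv⟩ := hnet S hS hint hbdd hdiam E G Finset.subset_union_left hGS α hα A₀ A₁ hA hJ hW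
  have hLhp0 : 0 < Lhp := by
    obtain ⟨i, rfl⟩ := hLhp.1
    exact hL i
  -- at the exceptional points, the constant absorbs the distance of the two splines
  let q : (Fin d → ℝ) → ℝ := fun g =>
    (HPS.supNorm T₀ T₁ (hp g (α g) - hp g (v g))).toReal / |v g - α g|
  have hq : ∀ g, 0 ≤ q g := fun g => by positivity
  let Q : ℝ := ∑ g ∈ G, q g
  have hQ : 0 ≤ Q := Finset.sum_nonneg fun g _ => hq g
  let C : ℝ := Q + 2 * max Lhp Lflat
  have hmax : 0 < max Lhp Lflat := lt_max_of_lt_left hLhp0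
  refine ⟨C, by positivity, fun ε hε K hK hKS => ?_⟩
  -- for `ε > 1 / 2` nothing is claimed about the complexity, and the network for `1 / 2` serves
  obtain ⟨F, hdep, hsize, hF1, hF2, hF3, hF4⟩ := hv (min ε (1 / 2)) (lt_min hε (by norm_num))
    (min_le_right _ _) K hK hKS
  have hmin : min ε (1 / 2) ≤ ε := min_le_left _ _
  have hsum : ∑ g ∈ G, |F.eval g - α g| = ∑ g ∈ G, |v g - α g| :=
    Finset.sum_congr rfl fun g hg => by rw [hF2 g hg]
  set σ : ℝ := ∑ g ∈ G, |v g - α g| with hσdef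
  have hσ : 0 ≤ σ := Finset.sum_nonneg fun _ _ => abs_nonneg _
  -- away from the exceptional points, a Lipschitz bound suffices
  have hlipbound : ∀ s ∈ S \ E, ∀ Λ : ℝ, 0 ≤ Λ → Λ ≤ max Lhp Lflat →
      HPS.supNorm T₀ T₁ (hp s (α s) - hp s (F.eval s)) ≤
        ENNReal.ofReal (Λ * |α s - F.eval s|) →
      HPS.supNorm T₀ T₁ (hp s (α s) - hp s (F.eval s)) ≤ ENNReal.ofReal (Λ * ε + C * σ) := by
    intro s hs Λ hΛ hΛmax hle
    refine hle.trans (ENNReal.ofReal_le_ofReal ?_)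
    have h1 : |α s - F.eval s| ≤ ε + 2 * σ := by
      rw [abs_sub_comm]
      exact (hF4 s hs).trans (by linarith)
    calc Λ * |α s - F.eval s| ≤ Λ * (ε + 2 * σ) := mul_le_mul_of_nonneg_left h1 hΛ
      _ = Λ * ε + 2 * Λ * σ := by ring
      _ ≤ Λ * ε + C * σ := by
          gcongr
          simp only [C]
          linarith
  refine ⟨F, fun hε2 => ?_, fun s hs hsK => (hF3 s hs hsK).trans hmin, fun s hs f _ => ?_,
    fun s hs hsG A hAflat hα1 hF f _ => ?_⟩
  · rw [min_eq_left hε2] at hdep hsize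
    exact ⟨hdep, hsize⟩
  · rw [hsum]
    refine HPS.supNorm_sub_le_add_ofReal f ?_
    by_cases hsG : s ∈ G
    · rw [hF2 s hsG]
      by_cases hvs : v s = α s
      · rw [hvs, HPS.supNorm_sub_self]
        exact zero_le
      · have hcont : Continuous (hp s (α s) - hp s (v s)) :=
          ((hspl s hs (α s)).continuous (hB _)).sub ((hspl s hs (v s)).continuous (hB _))
        have hpos : 0 < |v s - α s| := abs_pos.2 (sub_ne_zero.2 hvs)
        rw [← ENNReal.ofReal_toReal (HPS.supNorm_ne_top (T₀ := T₀) (T₁ := T₁) hcont)]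
        refine ENNReal.ofReal_le_ofReal ?_
        calc _ = q s * |v s - α s| := (div_mul_cancel₀ _ hpos.ne').symm
          _ ≤ Q * σ := mul_le_mul (Finset.single_le_sum (fun g _ => hq g) hsG)
              (Finset.single_le_sum (f := fun g => |v g - α g|) (fun _ _ => abs_nonneg _) hsG)
              hpos.le hQ
          _ ≤ C * σ := by
              gcongr
              simp only [C]
              linarith
          _ ≤ _ := le_add_of_nonneg_left (by positivity)
    · have hsE : s ∈ S \ E := ⟨hs, fun he => hsG (Finset.mem_union_left _ he)⟩
      obtain ⟨i, hi⟩ := Set.mem_iUnion.1 (hcover ⟨hs, hsG⟩)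
      have h1 := (hlip i s ⟨hs, hi⟩ hsG).lipschitzInParam (hL i).le _ (hJ s hsE) _ (hF1 s)
      have h2 : L i ≤ max Lhp Lflat := (hLhp.2 ⟨i, rfl⟩).trans (le_max_left _ _)
      refine hlipbound s hsE _ hmax.le le_rfl (h1.trans (ENNReal.ofReal_le_ofReal ?_))
      gcongr
  · rw [hsum]
    refine HPS.supNorm_sub_le_add_ofReal f ?_
    have hsE : s ∈ S \ E := ⟨hs, fun he => hsG (Finset.mem_union_left _ he)⟩
    exact hlipbound s hsE Lflat hLflat.le (le_max_right _ _) (hflat A hAflat s hs hsG _ hα1 _ hF)
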